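/- Let $R>0$ and $r>0$. For $\omega>0$ let $J_n$ be the Bessel functions of the first kind and $H^{(1)}_n$ the Hankel functions of the first kind, and put $$\tilde g_{E_{in}}(r,\omega)=-\tfrac12\pi\omega R\,J_1(\omega r)H^{(1)}_1(\omega R),\qquad \tilde g_{B_{in}}(r,\omega)=\tfrac i2\pi\omega R\,J_0(\omega r)H^{(1)}_1(\omega R)\qquad(r\le R),$$ $$\tilde g_{E_{out}}(r,\omega)=-\tfrac12\pi\omega R\,J_1(\omega R)H^{(1)}_1(\omega r),\qquad \tilde g_{B_{out}}(r,\omega)=\tfrac i2\pi\omega R\,J_1(\omega R)H^{(1)}_0(\omega r)\qquad(r\ge R).$$ Let $\tilde g$ be any one of these four kernels (with $r$ in its stated range) and let $$\tilde g_{HF}(r,\omega)=\tfrac12\sqrt{\tfrac Rr}\Big[\pm e^{i|r-R|\omega}+e^{i((R+r)\omega-\pi/2)}\Big],\qquad \tilde g_{SI}=\tilde g-\tilde g_{HF},$$ with the $+$ sign for $B_{in}$ and the $-$ sign for the other three. For a function $h$ on $(0,\infty)$ that is integrable on every $(0,\Lambda)$, write $\mathrm{Re}\big[\frac1\pi\int_0^\infty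 h(\omega)e^{-i\omega t}d\omega\big]$ for the limit, in the sense of tempered distributions in $t$, of $\mathrm{Re}\big[\frac1\pi\int_0^\Lambda h(\omega)e^{-i\omega t}d\omega\big]$ as $\Lambda\to\infty$. Then, for fixed $r$: 1. $\tilde g\sim\tilde g_{HF}$ as $\omega\to+\infty$, in the following sense. The difference $\tilde g(r,\omega)-\tilde g_{HF}(r,\omega)$ tends to $0$. Moreover there is a sequence of zeros $z_0<z_1<\cdots$ of $\tilde g_{HF}(r,\cdot)$, with gaps bounded below by a positive constant, such that for each $\varepsilon>0$ there are $\eta_n\to0$ with the property that for all sufficiently large $\omega$ with $|\omega-z_n|>\eta_n$ for all $n$ one has $\tilde g_{HF}(r,\omega)\neq0$ and $|\tilde g(r,\omega)/\tilde g_{HF}(r,\omega)-1|<\varepsilon$. 2. The remainder $\tilde g_{SI}(r,\cdot)$ is square-integrable on $(0,\infty)$. 3. $$g_{HF}(r,t):=\mathrm{Re}\Big[\tfrac1\pi\int_0^\infty\tilde g_{HF}(r,\omega)e^{-i\omega t}d\omega\Big]=\tfrac12\sqrt{\tfrac Rr}\Big[\pm\delta(t-|r-R|)-\mathrm{p.v.}\frac1{\pi(t-(R+r))}\Big]$$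 as tempered distributions in $t$, with the same sign convention. 4. $g_{HF}$ is the singular part of the time-domain Green's function: the distribution $g_{SI}(r,t)=\mathrm{Re}\big[\frac1\pi\int_0^\infty\tilde g_{SI}(r,\omega)e^{-i\omega t}d\omega\big]$ exists and is a real-valued function in $L^2(\mathbb R,dt)$, and the time-domain Green's function $g(r,t)=\mathrm{Re}\big[\frac1\pi\int_0^\infty\tilde g(r,\omega)e^{-i\omega t}d\omega\big]$ exists and equals $g_{SI}(r,t)+g_{HF}(r,t)$. -/

import Mathlib

open Real Set Filter Topology MeasureTheory
open scoped SchwartzMap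

namespace Solenoid

noncomputable section

/-! ### Bessel and Hankel functions of integer order on the positive half-line -/

/-- The Bessel function of the first kind `J_n`, by its power series. -/
def besselJ (n : ℕ) (x : ℝ) : ℝ :=
  ∑' k : ℕ, (-1) ^ k / ((k.factorial : ℝ) * ((n + k).factorial : ℝ)) * (x / 2) ^ (n + 2 * k)

/-- The Bessel function of the second kind `Y_n` (also written `N_n`) at `x > 0`, by its standard
ascending series.  The digamma values at positive integers are
`ψ (m + 1) = harmonic m - γ`, with `γ` the Euler-Mascheroni constant. -/
def besselY (n : ℕ) (x : ℝ) : ℝ :=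
  -(1 / π) * ∑ k ∈ Finset.range n, ((n - k - 1).factorial : ℝ) / (k.factorial : ℝ) * ((x / 2) ^ (2 * k) / (x / 2) ^ n)
    + 2 / π * Real.log (x / 2) * besselJ n x
    - 1 / π * ∑' k : ℕ,
        ((harmonic k : ℝ) + (harmonic (n + k) : ℝ) - 2 * Real.eulerMascheroniConstant)
          * ((-1) ^ k / ((k.factorial : ℝ) * ((n + k).factorial : ℝ))) * (x / 2) ^ (n + 2 * k)

/-- The Hankel function of the first kind `H_n^{(1)} = J_n + i Y_n` at `x > 0`. -/
def hankel1 (n : ℕ) (x : ℝ) : ℂ := (besselJ n x : ℂ) + Complex.I * (besselY n x : ℂ)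

/-! ### The four frequency-domain Green's functions of the solenoid -/

/-- Labels of the four fields: electric or magnetic, inside or outside the solenoid. -/
inductive Field
  | Ein
  | Eout
  | Bin
  | Bout

/-- The radii at which a field is considered: `r ≤ R` inside and `r ≥ R` outside the solenoid
of radius `R`. -/
def Field.Region (c : Field) (R r : ℝ) : Prop :=
  match c with
  | .Ein => r ≤ R
  | .Eout => R ≤ r
  | .Bin => r ≤ R
  | .Bout => R ≤ r

/-- The frequency-domain Green's functions `g̃(r, ω)`, for frequencies `ω > 0`. -/
def Field.kernel (c : Field) (R r ω : ℝ) : ℂ :=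
  match c with
  | .Ein => -1 / 2 * π * ω * R * besselJ 1 (ω * r) * hankel1 1 (ω * R)
  | .Eout => -1 / 2 * π * ω * R * besselJ 1 (ω * R) * hankel1 1 (ω * r)
  | .Bin => Complex.I / 2 * π * ω * R * besselJ 0 (ω * r) * hankel1 1 (ω * R)
  | .Bout => Complex.I / 2 * π * ω * R * besselJ 1 (ω * R) * hankel1 0 (ω * r)

/-- The sign `±`: plus for the magnetic field inside, minus for the other three fields. -/
def Field.sign (c : Field) : ℝ :=
  match c with
  | .Ein => -1
  | .Eout => -1
  | .Bin => 1
  | .Bout => -1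

/-- The high-frequency expression `g̃_HF(r, ω)`. -/
def Field.kernelHF (c : Field) (R r ω : ℝ) : ℂ :=
  1 / 2 * (√(R / r) : ℂ) *
    ((c.sign : ℂ) * Complex.exp (Complex.I * ((|r - R| * ω : ℝ) : ℂ))
      + Complex.exp (Complex.I * (((R + r) * ω - π / 2 : ℝ) : ℂ)))

/-- The remainder `g̃_SI = g̃ - g̃_HF`. -/
def Field.kernelSI (c : Field) (R r ω : ℝ) : ℂ := c.kernel R r ω - c.kernelHF R r ω

/-! ### Asymptotic equivalence away from zeros -/

/-- `f ∼ g` as `ω → +∞` in the sense appropriate to an oscillating `g` with zeros: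
there is a sequence of zeros `z 0 < z 1 < ⋯` of `g` with gaps bounded below such that, for each
`ε > 0`, outside a sequence of intervals around the `z n` whose half-lengths `η n` tend to zero,
`|f / g - 1| < ε` for all large `ω`. -/
def AsymptoticOffZeros (f g : ℝ → ℂ) : Prop :=
  ∃ z : ℕ → ℝ, (∀ n, g (z n) = 0) ∧ (∃ d : ℝ, 0 < d ∧ ∀ n, z n + d ≤ z (n + 1)) ∧
    ∀ ε : ℝ, 0 < ε → ∃ η : ℕ → ℝ, Tendsto η atTop (𝓝 0) ∧
      ∀ᶠ ω in atTop, (∀ n, η n < |ω - z n|) → g ω ≠ 0 ∧ ‖f ω / g ω - 1‖ < ε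

/-! ### The modified inverse Fourier transform, in the sense of distributions -/

/-- `Re [(1/π) ∫₀^Λ h(ω) e^{-iωt} dω]`. -/
def truncatedModifiedIFT (h : ℝ → ℂ) (Λ t : ℝ) : ℝ :=
  (1 / (π : ℂ) * ∫ ω in (0 : ℝ)..Λ, h ω * Complex.exp (-(Complex.I * ((ω * t : ℝ) : ℂ)))).re

/-- The tempered distribution `T` is `Re [(1/π) ∫₀^∞ h(ω) e^{-iωt} dω]`: `h` is integrable on each
`(0, Λ)`, and the integrals over `(0, Λ)` converge to `T` as `Λ → ∞` in the sense of tempered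
distributions in the variable `t`. -/
def IsModifiedIFT (h : ℝ → ℂ) (T : 𝓢'(ℝ, ℂ)) : Prop :=
  (∀ Λ : ℝ, 0 < Λ → IntervalIntegrable h volume 0 Λ) ∧
  ∀ φ : 𝓢(ℝ, ℂ),
    Tendsto (fun Λ : ℝ => ∫ t : ℝ, (truncatedModifiedIFT h Λ t : ℂ) * φ t) atTop (𝓝 (T φ))

/-! ### The Cauchy principal value of `1 / (t - c)` -/

lemma pv_bound (c : ℝ) (φ : 𝓢(ℝ, ℂ)) {s : ℝ} (hs : 0 < s) :
    ‖(φ (c + s) - φ (c - s)) / (s : ℂ)‖ ≤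
      (2 * SchwartzMap.seminorm ℂ 0 1 φ + 2 * SchwartzMap.seminorm ℂ 1 0 φ
        + 2 * |c| * SchwartzMap.seminorm ℂ 0 0 φ) * (1 + s ^ 2)⁻¹ := by
  have h01 : ‖φ (c + s) - φ (c - s)‖ ≤ SchwartzMap.seminorm ℂ 0 1 φ * (2 * s) := by
    have h := Convex.norm_image_sub_le_of_norm_deriv_le (𝕜 := ℝ) (f := φ) (s := Set.univ)
      (C := SchwartzMap.seminorm ℂ 0 1 φ) (x := c - s) (y := c + s)
      (fun x _ => φ.differentiableAt) (fun x _ => by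
        have := SchwartzMap.le_seminorm' ℂ 0 1 φ x
        simpa [iteratedDeriv_one] using this) convex_univ (mem_univ _) (mem_univ _)
    have e : ‖c + s - (c - s)‖ = 2 * s := by
      rw [show c + s - (c - s) = 2 * s by ring, Real.norm_of_nonneg (by positivity)]
    rwa [e] at h
  have key : ∀ x : ℝ, s ≤ |x| + |c| → s * ‖φ x‖ ≤
      SchwartzMap.seminorm ℂ 1 0 φ + |c| * SchwartzMap.seminorm ℂ 0 0 φ := by
    intro x hx
    have h1 := SchwartzMap.norm_pow_mul_le_seminorm ℂ φ 1 x
    have h0 := SchwartzMap.norm_le_seminorm ℂ φ x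
    rw [pow_one, Real.norm_eq_abs] at h1
    nlinarith [mul_le_mul_of_nonneg_right hx (norm_nonneg (φ x)),
      mul_le_mul_of_nonneg_left h0 (abs_nonneg c)]
  have hp := key (c + s) (by
    have := abs_add_le (c + s) (-c); rw [abs_neg] at this
    rw [show c + s + -c = s by ring, abs_of_pos hs] at this; exact this)
  have hm := key (c - s) (by
    have := abs_add_le (c - s) (-c); rw [abs_neg] at this
    rw [show c - s + -c = -s by ring, abs_neg, abs_of_pos hs] at this; exact this)
  have h00 := norm_sub_le (φ (c + s)) (φ (c - s))
  rw [norm_div, Complex.norm_real, Real.norm_of_nonneg hs.le, ← div_eq_mul_inv,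
    div_le_div_iff₀ hs (by positivity)]
  nlinarith [mul_le_mul_of_nonneg_left h00 (sq_nonneg s)]

lemma pv_integrableOn (c : ℝ) (φ : 𝓢(ℝ, ℂ)) :
    IntegrableOn (fun s : ℝ => (φ (c + s) - φ (c - s)) / (s : ℂ)) (Ioi 0) := by
  refine Integrable.mono' ((integrable_inv_one_add_sq.const_mul _).integrableOn)
    ?_ ((ae_restrict_iff' measurableSet_Ioi).2 (Eventually.of_forall fun s hs =>
      pv_bound c φ hs))
  have := φ.continuous
  exact (Measurable.div (by fun_prop) (by fun_prop)).aestronglyMeasurable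

/-- The tempered distribution `p.v. 1 / (t - c)`, in symmetric form
`φ ↦ ∫₀^∞ (φ(c + s) - φ(c - s)) / s ds`; see `tendsto_pvInv`. -/
def pvInv (c : ℝ) : 𝓢'(ℝ, ℂ) :=
  ContinuousLinearMap.toPointwiseConvergenceCLM _ _ _ _ <|
    SchwartzMap.mkCLMtoNormedSpace (𝕜 := ℂ)
      (fun φ : 𝓢(ℝ, ℂ) => ∫ s in Ioi (0 : ℝ), (φ (c + s) - φ (c - s)) / (s : ℂ))
      (fun f g => by
        rw [← integral_add (pv_integrableOn c f) (pv_integrableOn c g)]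
        congr 1; ext s; simp only [add_apply]; ring)
      (fun a f => by
        rw [RingHom.id_apply, smul_eq_mul, ← integral_const_mul]
        congr 1; ext s; simp only [smul_apply, smul_eq_mul]; ring)
      ⟨{(0, 1), (1, 0), (0, 0)}, (4 + 2 * |c|) * π, by positivity, fun f => by
        set S := (({(0, 1), (1, 0), (0, 0)} : Finset (ℕ × ℕ)).sup
          (schwartzSeminormFamily ℂ ℝ ℂ)) f with hS
        have hle : ∀ p ∈ ({(0, 1), (1, 0), (0, 0)} : Finset (ℕ × ℕ)),
            SchwartzMap.seminorm ℂ p.1 p.2 f ≤ S := fun p hp =>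
          (Finset.le_sup (f := schwartzSeminormFamily ℂ ℝ ℂ) hp) f
        have h01 := hle (0, 1) (by simp)
        have h10 := hle (1, 0) (by simp)
        have h00 := hle (0, 0) (by simp)
        have hB : 2 * SchwartzMap.seminorm ℂ 0 1 f + 2 * SchwartzMap.seminorm ℂ 1 0 f
            + 2 * |c| * SchwartzMap.seminorm ℂ 0 0 f ≤ (4 + 2 * |c|) * S := by
          nlinarith [mul_le_mul_of_nonneg_left h00 (abs_nonneg c)]
        have hS0 : 0 ≤ S := (apply_nonneg (SchwartzMap.seminorm ℂ 0 0) f).trans h00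
        calc ‖∫ s in Ioi (0 : ℝ), (f (c + s) - f (c - s)) / (s : ℂ)‖
            ≤ ∫ s in Ioi (0 : ℝ), ((4 + 2 * |c|) * S) * (1 + s ^ 2)⁻¹ := by
              refine norm_integral_le_of_norm_le
                ((integrable_inv_one_add_sq.const_mul _).integrableOn)
                ((ae_restrict_iff' measurableSet_Ioi).2 (Eventually.of_forall fun s hs => ?_))
              exact (pv_bound c f hs).trans
                (mul_le_mul_of_nonneg_right hB (by positivity))
          _ ≤ ∫ s : ℝ, ((4 + 2 * |c|) * S) * (1 + s ^ 2)⁻¹ :=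
              setIntegral_le_integral (integrable_inv_one_add_sq.const_mul _)
                (Eventually.of_forall fun s => by positivity)
          _ = (4 + 2 * |c|) * π * S := by
              rw [integral_const_mul, integral_univ_inv_one_add_sq]; ring⟩

lemma pvInv_apply (c : ℝ) (φ : 𝓢(ℝ, ℂ)) :
    pvInv c φ = ∫ s in Ioi (0 : ℝ), (φ (c + s) - φ (c - s)) / (s : ℂ) := rfl

lemma integral_symm_eq (c : ℝ) (φ : 𝓢(ℝ, ℂ)) {ε : ℝ} (hε : 0 < ε) :
    ∫ t in {t : ℝ | ε < |t - c|}, φ t / ((t - c : ℝ) : ℂ) =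
      ∫ s in Ioi ε, (φ (c + s) - φ (c - s)) / (s : ℂ) := by
  have hset : {t : ℝ | ε < |t - c|} = Ioi (c + ε) ∪ Iio (c - ε) := by
    ext t
    simp only [mem_ofPred_eq, lt_abs, mem_union, mem_Ioi, mem_Iio]
    constructor <;> rintro (h | h) <;> [left; right; left; right] <;> linarith
  have hint : IntegrableOn (fun t : ℝ => φ t / ((t - c : ℝ) : ℂ)) {t : ℝ | ε < |t - c|} := by
    have hmeas : MeasurableSet {t : ℝ | ε < |t - c|} := by
      rw [hset]; exact measurableSet_Ioi.union measurableSet_Iio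
    refine Integrable.mono' ((φ.integrable (μ := volume)).norm.mul_const ε⁻¹).integrableOn ?_
      ((ae_restrict_iff' hmeas).2 (Eventually.of_forall fun t ht => ?_))
    · have := φ.continuous
      exact (Measurable.div (by fun_prop) (by fun_prop)).aestronglyMeasurable
    · rw [norm_div, Complex.norm_real, Real.norm_eq_abs, div_eq_mul_inv]
      exact mul_le_mul_of_nonneg_left (inv_anti₀ hε (le_of_lt ht)) (norm_nonneg _)
  have hdisj : Disjoint (Ioi (c + ε)) (Iio (c - ε)) := by
    rw [Set.disjoint_left]; intro t h1 h2
    simp only [mem_Ioi, mem_Iio] at h1 h2; linarith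
  rw [hset] at hint ⊢
  rw [setIntegral_union hdisj measurableSet_Iio hint.left_of_union hint.right_of_union]
  have e1 : ∫ t in Ioi (c + ε), φ t / ((t - c : ℝ) : ℂ) =
      ∫ s in Ioi ε, φ (c + s) / (s : ℂ) := by
    have := (measurePreserving_add_left (volume : Measure ℝ) c).setIntegral_preimage_emb
      (MeasurableEquiv.addLeft c).measurableEmbedding
      (fun t : ℝ => φ t / ((t - c : ℝ) : ℂ)) (Ioi (c + ε))
    rw [← this]
    simp
  have e2 : ∫ t in Iio (c - ε), φ t / ((t - c : ℝ) : ℂ) =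
      ∫ s in Ioi ε, -(φ (c - s) / (s : ℂ)) := by
    have := (Measure.measurePreserving_sub_left (volume : Measure ℝ) c).setIntegral_preimage_emb
      (MeasurableEquiv.subLeft c).measurableEmbedding
      (fun t : ℝ => φ t / ((t - c : ℝ) : ℂ)) (Iio (c - ε))
    rw [← this]
    simp [div_neg]
  have i1 : IntegrableOn (fun s : ℝ => φ (c + s) / (s : ℂ)) (Ioi ε) := by
    have := ((measurePreserving_add_left (volume : Measure ℝ) c).integrableOn_comp_preimage
      (MeasurableEquiv.addLeft c).measurableEmbedding).2 hint.left_of_union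
    simpa [Function.comp_def] using this
  have i2 : IntegrableOn (fun s : ℝ => -(φ (c - s) / (s : ℂ))) (Ioi ε) := by
    have := ((Measure.measurePreserving_sub_left (volume : Measure ℝ) c).integrableOn_comp_preimage
      (MeasurableEquiv.subLeft c).measurableEmbedding).2 hint.right_of_union
    simpa [Function.comp_def, div_neg] using this
  rw [e1, e2, ← integral_add i1 i2]
  congr 1; ext s; ring

/-- `pvInv c` is the Cauchy principal value of `1 / (t - c)`. -/
theorem tendsto_pvInv (c : ℝ) (φ : 𝓢(ℝ, ℂ)) :
    Tendsto (fun ε : ℝ => ∫ t in {t : ℝ | ε < |t - c|}, φ t / ((t - c : ℝ) : ℂ))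
      (𝓝[>] 0) (𝓝 (pvInv c φ)) := by
  have h : Tendsto (fun ε : ℝ => ∫ s in Ioi ε, (φ (c + s) - φ (c - s)) / (s : ℂ))
      (𝓝[>] 0) (𝓝 (pvInv c φ)) := by
    rw [pvInv_apply]
    have hA : AECover (volume.restrict (Ioi (0 : ℝ))) (𝓝[>] (0 : ℝ)) fun ε : ℝ => Ioi ε :=
      aecover_Ioi_of_Ioi (tendsto_id.mono_left nhdsWithin_le_nhds)
    refine (hA.integral_tendsto_of_countably_generated (pv_integrableOn c φ)).congr' ?_
    filter_upwards [self_mem_nhdsWithin] with ε hε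
    rw [Measure.restrict_restrict measurableSet_Ioi,
      inter_eq_left.2 (Ioi_subset_Ioi (le_of_lt hε))]
  refine h.congr' ?_
  filter_upwards [self_mem_nhdsWithin] with ε hε
  exact (integral_symm_eq c φ hε).symm

/-! ### The high-frequency part in the time domain -/

/-- The tempered distribution
`g_HF(r, t) = ½ √(R/r) [± δ(t - |r - R|) - p.v. 1 / (π (t - (R + r)))]`. -/
def Field.timeHF (c : Field) (R r : ℝ) : 𝓢'(ℝ, ℂ) :=
  ((1 / 2 * √(R / r) : ℝ) : ℂ) •
    ((c.sign : ℂ) • TemperedDistribution.delta |r - R| - (1 / (π : ℂ)) • pvInv (R + r))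

end

end Solenoid

open Real Set Filter Topology MeasureTheory
open scoped SchwartzMap

namespace Solenoid

noncomputable section

/-! ### Entire power series -/

/-! Everything rests on the large-argument behaviour of `J_n` and `H_n^{(1)}` for n = 0, 1 with
error relative to the amplitude of order 1/x, and this has to be extracted from the ascending
series. The link is the integral (4/π) e^{i(x-π/4)} ∫₀^∞ e^{-2xz²} / √(1 + iz²) dz, which is shown
to be H_0^{(1)}; minus its derivative is then H_1^{(1)}.

Both candidates satisfy the first-order system f₀' = -f₁, (x f₁)' = x f₀: for the series by
comparing coefficients, for the integral by an integration by parts (`momentA_relation`). Both have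
the limit form 1 + (2i/π)(log(x/2) + γ) at the origin; on the integral side γ enters as -Γ'(1)
(`tendsto_hankelInt0_sub_log`). A solution that tends to 0 at the origin vanishes, by its Wronskians
with J and Y (`IsBesselPair.eq_zero_of_tendsto`), so the candidates agree. In the integral,
replacing 1/√(1 + iz²) by 1 leaves the leading term, and the error is a Gaussian second moment,
smaller by a factor x (`exists_hankel1_bound`).

In ω J_m(ωp) H_n(ωq) the factor ω cancels the decay of the two amplitudes, and cosine times
exponential splits into frequencies q + p = R + r and q - p = |r - R|. This leading part is exactly
the high-frequency kernel (`Field.kernelHF_eq`), so the remainder is O(1/ω)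
(`Field.exists_kernelSI_bound`). As the kernel also has a finite limit at ω = 0, the remainder is
square-integrable. The modulus of the high-frequency kernel is a multiple of |sin|, which at
distance of order ω^{-1/2} from its zeros dominates 1/ω; this gives the ratio statement.

In the time domain, the real part of a half-line transform is the Fourier transform of a Hermitian
extension (`truncatedModifiedIFT_eq_fourier`). For e^{iaω} that extension is a full character, and
Fourier inversion yields the delta. The exponential with phase -π/2 has an explicit truncated
transform, whose oscillating part dies by Riemann-Lebesgue and leaves the principal value. For the
remainder, Plancherel gives an L² limit, real because its approximants are. The Green's function
itself follows by linearity. -/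

lemma summable_entire {a : ℕ → ℝ} {C : ℝ} (ha : ∀ k, |a k| ≤ C / k.factorial) (t : ℝ) :
    Summable fun k => a k * t ^ k := by
  refine Summable.of_norm_bounded ((Real.summable_pow_div_factorial |t|).mul_left C) fun k => ?_
  rw [norm_mul, norm_pow, Real.norm_eq_abs, Real.norm_eq_abs]
  calc |a k| * |t| ^ k ≤ C / k.factorial * |t| ^ k := by gcongr; exact ha k
    _ = _ := by ring

/-- Termwise differentiation is legitimate on a ball slightly larger than |t|, where the
differentiated series is dominated by a shifted exponential series. -/
lemma hasDerivAt_entire {a : ℕ → ℝ} {C : ℝ} (ha : ∀ k, |a k| ≤ C / k.factorial) (t : ℝ) :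
    HasDerivAt (fun t => ∑' k, a k * t ^ k) (∑' k : ℕ, (k + 1) * a (k + 1) * t ^ k) t := by
  set ρ := |t| + 1
  have hu : Summable fun k : ℕ => C / k.factorial * (k * ρ ^ (k - 1)) := by
    rw [← summable_nat_add_iff 1]
    refine ((Real.summable_pow_div_factorial ρ).mul_left C).congr fun k => ?_
    rw [Nat.factorial_succ, Nat.add_sub_cancel]
    push_cast
    field_simp
  have h := hasDerivAt_tsum_of_isPreconnected (g := fun k t => a k * t ^ k)
    (g' := fun k y => a k * (k * y ^ (k - 1))) (t := Metric.ball (0 : ℝ) ρ) (y₀ := 0) (y := t)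
    hu Metric.isOpen_ball (convex_ball _ _).isPreconnected
    (fun k y _ => (hasDerivAt_pow k y).const_mul _)
    (fun k y hy => by
      have hy : |y| ≤ ρ := by simpa using (Metric.mem_ball.1 hy).le
      rw [norm_mul, norm_mul, norm_pow, Real.norm_eq_abs, Real.norm_eq_abs, Real.norm_eq_abs,
        Nat.abs_cast]
      have := ha k
      have h0 : 0 ≤ C / k.factorial := (abs_nonneg _).trans this
      gcongr)
    (Metric.mem_ball_self (by positivity)) (summable_entire ha 0)
    (by simp [ρ])
  refine h.congr_deriv ?_
  rw [Summable.tsum_eq_zero_add]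
  · simp only [Nat.cast_zero, zero_mul, mul_zero, zero_add, Nat.cast_add, Nat.cast_one,
      Nat.add_sub_cancel]
    exact tsum_congr fun k => by ring
  · refine Summable.of_norm_bounded hu fun k => ?_
    rw [norm_mul, norm_mul, norm_pow, Real.norm_eq_abs, Real.norm_eq_abs, Real.norm_eq_abs,
      Nat.abs_cast]
    have := ha k
    have h0 : 0 ≤ C / k.factorial := (abs_nonneg _).trans this
    have : |t| ≤ ρ := by simp [ρ]
    gcongr

/-- Index shift. Applied to a k = k * c k, it identifies t times the derivative of ∑ c k t^k with
the series whose coefficients are k * c k. -/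
lemma mul_tsum_succ {a : ℕ → ℝ} {C : ℝ} (ha : ∀ k, |a k| ≤ C / k.factorial) (t : ℝ) :
    t * ∑' k, a (k + 1) * t ^ k = ∑' k, a k * t ^ k - a 0 := by
  rw [(summable_entire ha t).tsum_eq_zero_add, ← tsum_mul_left]
  simp only [pow_zero, mul_one, add_sub_cancel_left]
  exact tsum_congr fun k => by ring

/-! ### The power series of `J_n` and `Y_n` -/

/-- Coefficients of the series of `J_n`. -/
def coeffJ (n k : ℕ) : ℝ := (-1) ^ k / ((k.factorial : ℝ) * ((n + k).factorial : ℝ))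

/-- Coefficients of the regular part of the series of `Y_n`. -/
def coeffY (n k : ℕ) : ℝ :=
  ((harmonic k : ℝ) + (harmonic (n + k) : ℝ) - 2 * Real.eulerMascheroniConstant) * coeffJ n k

/-- `J_n (x) = (x / 2) ^ n * seriesJ n (x ^ 2 / 4)`. -/
def seriesJ (n : ℕ) (t : ℝ) : ℝ := ∑' k, coeffJ n k * t ^ k

/-- The regular part of the ascending series of `Y_n`, as a function of `x ^ 2 / 4`. -/
def seriesY (n : ℕ) (t : ℝ) : ℝ := ∑' k, coeffY n k * t ^ k

lemma abs_coeffJ_le (n k : ℕ) : |coeffJ n k| ≤ 1 / k.factorial := by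
  rw [coeffJ, abs_div, abs_pow, abs_neg, abs_one, one_pow, abs_of_pos (by positivity)]
  have h1 : (1 : ℝ) ≤ (n + k).factorial := by exact_mod_cast Nat.factorial_pos _
  exact one_div_le_one_div_of_le (by positivity) (le_mul_of_one_le_right (by positivity) h1)

lemma harmonic_nonneg_real (n : ℕ) : (0 : ℝ) ≤ harmonic n := by
  have : (0 : ℚ) ≤ harmonic n := by unfold harmonic; positivity
  exact_mod_cast this

lemma harmonic_le_self (n : ℕ) : (harmonic n : ℝ) ≤ n := by
  induction n with
  | zero => simp
  | succ n ih =>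
    rw [harmonic_succ]
    push_cast
    have : ((n : ℝ) + 1)⁻¹ ≤ 1 := inv_le_one_of_one_le₀ (by linarith [n.cast_nonneg (α := ℝ)])
    linarith

/-- Harmonic numbers grow at most linearly, so one of the two factorials in the denominator absorbs
them and the other remains for convergence. -/
lemma abs_coeffY_le (n k : ℕ) : |coeffY n k| ≤ 4 / k.factorial := by
  have h1 := harmonic_nonneg_real k
  have h2 := harmonic_nonneg_real (n + k)
  have h3 := harmonic_le_self k
  have h4 := harmonic_le_self (n + k)
  have h5 := Real.one_half_lt_eulerMascheroniConstant
  have h6 := Real.eulerMascheroniConstant_lt_two_thirds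
  rw [coeffY, abs_mul, coeffJ, abs_div, abs_pow, abs_neg, abs_one, one_pow,
    abs_of_pos (a := (k.factorial : ℝ) * _) (by positivity)]
  have h7 : ((n + k : ℕ) : ℝ) ≤ (n + k).factorial := by exact_mod_cast Nat.self_le_factorial _
  have h8 : (1 : ℝ) ≤ (n + k).factorial := by exact_mod_cast Nat.factorial_pos _
  have h9 : (k : ℝ) ≤ (n + k : ℕ) := by push_cast; linarith [n.cast_nonneg (α := ℝ)]
  have : |(harmonic k : ℝ) + harmonic (n + k) - 2 * Real.eulerMascheroniConstant|
      ≤ 4 * (n + k).factorial := by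
    rw [abs_le]; constructor <;> linarith
  rw [mul_one_div, div_le_div_iff₀ (by positivity) (by positivity)]
  nlinarith [(by positivity : (0 : ℝ) < k.factorial)]

lemma besselJ_eq (n : ℕ) (x : ℝ) : besselJ n x = (x / 2) ^ n * seriesJ n (x ^ 2 / 4) := by
  rw [besselJ, seriesJ, ← tsum_mul_left]
  refine tsum_congr fun k => ?_
  rw [coeffJ, pow_add, pow_mul, div_pow x 2 2]
  norm_num
  ring

lemma tsum_coeffY_eq (n : ℕ) (x : ℝ) :
    ∑' k : ℕ, ((harmonic k : ℝ) + (harmonic (n + k) : ℝ) - 2 * Real.eulerMascheroniConstant)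
          * ((-1) ^ k / ((k.factorial : ℝ) * ((n + k).factorial : ℝ))) * (x / 2) ^ (n + 2 * k) =
      (x / 2) ^ n * seriesY n (x ^ 2 / 4) := by
  rw [seriesY, ← tsum_mul_left]
  refine tsum_congr fun k => ?_
  rw [coeffY, coeffJ, pow_add, pow_mul, div_pow x 2 2]
  norm_num
  ring

lemma besselY_zero_eq (x : ℝ) :
    besselY 0 x = 2 / π * Real.log (x / 2) * besselJ 0 x - 1 / π * seriesY 0 (x ^ 2 / 4) := by
  rw [besselY, tsum_coeffY_eq]
  simp

lemma besselY_one_eq (x : ℝ) :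
    besselY 1 x = -(2 / π) / x + 2 / π * Real.log (x / 2) * besselJ 1 x
      - 1 / π * (x / 2 * seriesY 1 (x ^ 2 / 4)) := by
  rw [besselY, tsum_coeffY_eq]
  simp
  ring

lemma coeffJ_one_eq (k : ℕ) : (k + 1) * coeffJ 0 (k + 1) = - coeffJ 1 k := by
  simp only [coeffJ, zero_add, add_comm 1 k, Nat.factorial_succ, pow_succ]
  push_cast
  field_simp

lemma coeffJ_zero_eq (k : ℕ) : (k + 1) * coeffJ 1 k = coeffJ 0 k := by
  simp only [coeffJ, zero_add, add_comm 1 k, Nat.factorial_succ]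
  push_cast
  field_simp

lemma hasDerivAt_seriesJ_zero (t : ℝ) : HasDerivAt (seriesJ 0) (-seriesJ 1 t) t := by
  refine (hasDerivAt_entire (abs_coeffJ_le 0) t).congr_deriv ?_
  simp only [seriesJ]
  rw [← tsum_neg]
  exact tsum_congr fun k => by rw [coeffJ_one_eq]; ring

/-- The left side is the derivative of t * `seriesJ 1` t, so this is `coeffJ_zero_eq` read off
coefficientwise; it encodes (x J_1)' = x J_0 in the variable x²/4. -/
lemma hasDerivAt_seriesJ_one (t : ℝ) :
    ∃ d, HasDerivAt (seriesJ 1) d t ∧ seriesJ 1 t + t * d = seriesJ 0 t := by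
  refine ⟨_, hasDerivAt_entire (abs_coeffJ_le 1) t, ?_⟩
  set b : ℕ → ℝ := fun k => k * coeffJ 1 k with hb
  have hbb : ∀ k, |b k| ≤ 1 / k.factorial := fun k => by
    have e : b k = k / (k + 1) * coeffJ 0 k := by
      rw [← coeffJ_zero_eq, hb]; field_simp
    rw [e, abs_mul, abs_of_nonneg (by positivity : (0 : ℝ) ≤ k / (k + 1))]
    have : (k : ℝ) / (k + 1) ≤ 1 := by rw [div_le_one (by positivity)]; linarith
    calc _ ≤ 1 * |coeffJ 0 k| := by gcongr
      _ ≤ _ := by rw [one_mul]; exact abs_coeffJ_le 0 k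
  have := mul_tsum_succ hbb t
  simp only [hb, Nat.cast_add, Nat.cast_one, Nat.cast_zero, zero_mul, sub_zero] at this
  rw [this, seriesJ, seriesJ, ← Summable.tsum_add (summable_entire (abs_coeffJ_le 1) t)
    (summable_entire hbb t)]
  exact tsum_congr fun k => by rw [← coeffJ_zero_eq]; ring

/-- Order 0 carries 2 h_{k+1} and order 1 carries h_k + h_{k+1}, with h the harmonic numbers; the
discrepancy 1/(k+1) sums to `seriesJ 0` t - 1. In Y_0' = -Y_1 the first term cancels J_0 times the
derivative of the logarithm, and the 1 accounts for the pole of Y_1. -/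
lemma hasDerivAt_seriesY_zero (t : ℝ) :
    ∃ d, HasDerivAt (seriesY 0) d t ∧ t * d = seriesJ 0 t - 1 - t * seriesY 1 t := by
  refine ⟨_, hasDerivAt_entire (abs_coeffY_le 0) t, ?_⟩
  have hJ := mul_tsum_succ (abs_coeffJ_le 0) t
  have h0 : coeffJ 0 0 = 1 := by simp [coeffJ]
  have hs : Summable fun k => coeffJ 0 (k + 1) * t ^ k := by
    refine summable_entire (C := 1) (fun k => (abs_coeffJ_le 0 (k + 1)).trans ?_) t
    have : (k.factorial : ℝ) ≤ (k + 1).factorial := by exact_mod_cast Nat.factorial_le (by lia)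
    gcongr
  rw [h0] at hJ
  rw [seriesJ, seriesY, ← hJ, ← mul_sub, ← Summable.tsum_sub hs
    (summable_entire (abs_coeffY_le 1) t)]
  congr 1
  refine tsum_congr fun k => ?_
  have e := coeffJ_one_eq k
  have e' : coeffJ 0 (k + 1) = - coeffJ 1 k / (k + 1) := by
    rw [← e]; field_simp
  simp only [coeffY, zero_add, add_comm 1 k, harmonic_succ]
  rw [e']
  push_cast
  field_simp
  ring

lemma hasDerivAt_seriesY_one (t : ℝ) :
    ∃ d, HasDerivAt (seriesY 1) d t ∧
      seriesY 1 t + t * d = seriesY 0 t + seriesJ 1 t := by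
  refine ⟨_, hasDerivAt_entire (abs_coeffY_le 1) t, ?_⟩
  have e : ∀ k : ℕ, coeffY 0 k + coeffJ 1 k = (k + 1) * coeffY 1 k := fun k => by
    simp only [coeffY, ← coeffJ_zero_eq, zero_add, add_comm 1 k, harmonic_succ]
    push_cast
    field_simp
    ring
  set b : ℕ → ℝ := fun k => k * coeffY 1 k with hb
  -- The factor k costs nothing: b k = (k+1) c_k - c_k with c_k = `coeffY 1 k`, and (k+1) c_k is
  -- again a combination of controlled coefficients; 9 = 4 + 1 + 4.
  have hbb : ∀ k, |b k| ≤ 9 / k.factorial := fun k => by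
    have e : b k = coeffY 0 k + coeffJ 1 k - coeffY 1 k := by rw [e, hb]; ring
    rw [e]
    have h1 := abs_coeffY_le 0 k
    have h2 := abs_coeffY_le 1 k
    have h3 := abs_coeffJ_le 1 k
    calc _ ≤ |coeffY 0 k| + |coeffJ 1 k| + |coeffY 1 k| :=
          (abs_sub _ _).trans (by gcongr; exact abs_add_le _ _)
      _ ≤ 4 / k.factorial + 1 / k.factorial + 4 / k.factorial := by gcongr
      _ = _ := by ring
  have := mul_tsum_succ hbb t
  simp only [hb, Nat.cast_add, Nat.cast_one, Nat.cast_zero, zero_mul, sub_zero] at this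
  rw [this, seriesJ, seriesY, seriesY, ← Summable.tsum_add (summable_entire (abs_coeffY_le 1) t)
    (summable_entire hbb t), ← Summable.tsum_add (summable_entire (abs_coeffY_le 0) t)
    (summable_entire (abs_coeffJ_le 1) t)]
  exact tsum_congr fun k => by rw [← add_mul, ← add_mul, e]; simp only [hb]; ring

/-! ### The first-order system of `J_0, J_1` and `Y_0, Y_1` -/

lemma hasDerivAt_sq_div_four (x : ℝ) : HasDerivAt (fun x : ℝ => x ^ 2 / 4) (x / 2) x := by
  refine ((hasDerivAt_pow 2 x).div_const 4).congr_deriv ?_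
  norm_num
  ring

lemma hasDerivAt_besselJ_zero (x : ℝ) : HasDerivAt (besselJ 0) (-besselJ 1 x) x := by
  have h := (hasDerivAt_seriesJ_zero (x ^ 2 / 4)).comp x (hasDerivAt_sq_div_four x)
  have e : besselJ 0 = seriesJ 0 ∘ fun x => x ^ 2 / 4 := by
    ext y; simp [besselJ_eq]
  rw [e, besselJ_eq]
  refine h.congr_deriv ?_
  ring

lemma hasDerivAt_mul_besselJ_one (x : ℝ) :
    HasDerivAt (fun x => x * besselJ 1 x) (x * besselJ 0 x) x := by
  obtain ⟨d, hd, e⟩ := hasDerivAt_seriesJ_one (x ^ 2 / 4)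
  have h := ((hasDerivAt_sq_div_four x).const_mul 2).mul
    (hd.comp x (hasDerivAt_sq_div_four x))
  refine (h.congr_deriv ?_).congr_of_eventuallyEq (Eventually.of_forall fun y => ?_)
  · rw [besselJ_eq, ← e]
    simp
    ring
  · simp [besselJ_eq]
    ring

lemma hasDerivAt_log_half {x : ℝ} (hx : 0 < x) :
    HasDerivAt (fun x => Real.log (x / 2)) (1 / x) x := by
  refine ((Real.hasDerivAt_log (by positivity : x / 2 ≠ 0)).comp x
    ((hasDerivAt_id x).div_const 2)).congr_deriv ?_
  field_simp

lemma hasDerivAt_besselY_zero {x : ℝ} (hx : 0 < x) :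
    HasDerivAt (besselY 0) (-besselY 1 x) x := by
  obtain ⟨d, hd, e⟩ := hasDerivAt_seriesY_zero (x ^ 2 / 4)
  have h := (((hasDerivAt_log_half hx).const_mul (2 / π)).mul (hasDerivAt_besselJ_zero x)).sub
    ((hd.comp x (hasDerivAt_sq_div_four x)).const_mul (1 / π))
  have e1 : besselY 0 = fun x => 2 / π * Real.log (x / 2) * besselJ 0 x
      - 1 / π * seriesY 0 (x ^ 2 / 4) := funext besselY_zero_eq
  rw [e1]
  refine h.congr_deriv ?_
  have hd' : d = (besselJ 0 x - 1) * 4 / x ^ 2 - seriesY 1 (x ^ 2 / 4) := by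
    have : besselJ 0 x = seriesJ 0 (x ^ 2 / 4) := by simp [besselJ_eq]
    rw [this]
    field_simp
    linear_combination 4 * e
  rw [besselY_one_eq, hd']
  field_simp
  ring

lemma hasDerivAt_mul_besselY_one {x : ℝ} (hx : 0 < x) :
    HasDerivAt (fun x => x * besselY 1 x) (x * besselY 0 x) x := by
  obtain ⟨d, hd, e⟩ := hasDerivAt_seriesY_one (x ^ 2 / 4)
  have h := ((((hasDerivAt_log_half hx).const_mul (2 / π)).mul
    (hasDerivAt_mul_besselJ_one x)).sub
    ((((hasDerivAt_sq_div_four x).const_mul 2).mul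
      (hd.comp x (hasDerivAt_sq_div_four x))).const_mul (1 / π))).const_add (-(2 / π))
  refine (h.congr_deriv ?_).congr_of_eventuallyEq ?_
  · simp only [besselY_zero_eq, besselJ_eq 1, Function.comp_def]
    have : d = (seriesY 0 (x ^ 2 / 4) + seriesJ 1 (x ^ 2 / 4) - seriesY 1 (x ^ 2 / 4)) * 4
        / x ^ 2 := by
      field_simp
      linear_combination 4 * e
    rw [this]
    field_simp
    ring
  · filter_upwards [lt_mem_nhds hx] with y hy
    simp [besselY_one_eq]
    field_simp
    ring

/-! ### Behaviour at the origin -/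

lemma tendsto_seriesJ_comp (n : ℕ) :
    Tendsto (fun x : ℝ => seriesJ n (x ^ 2 / 4)) (𝓝[>] 0) (𝓝 (coeffJ n 0)) := by
  have h : Continuous (seriesJ n) :=
    continuous_iff_continuousAt.2 fun t => (hasDerivAt_entire (abs_coeffJ_le n) t).continuousAt
  have e : seriesJ n (0 ^ 2 / 4) = coeffJ n 0 := by
    rw [seriesJ, tsum_eq_single 0 (fun k hk => by simp [hk])]; simp
  rw [← e]
  exact ((by fun_prop : Continuous fun x : ℝ => seriesJ n (x ^ 2 / 4)).tendsto 0).mono_left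
    nhdsWithin_le_nhds

lemma tendsto_seriesY_comp (n : ℕ) :
    Tendsto (fun x : ℝ => seriesY n (x ^ 2 / 4)) (𝓝[>] 0) (𝓝 (coeffY n 0)) := by
  have h : Continuous (seriesY n) :=
    continuous_iff_continuousAt.2 fun t => (hasDerivAt_entire (abs_coeffY_le n) t).continuousAt
  have e : seriesY n (0 ^ 2 / 4) = coeffY n 0 := by
    rw [seriesY, tsum_eq_single 0 (fun k hk => by simp [hk])]; simp
  rw [← e]
  exact ((by fun_prop : Continuous fun x : ℝ => seriesY n (x ^ 2 / 4)).tendsto 0).mono_left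
    nhdsWithin_le_nhds

lemma tendsto_id_zero_right : Tendsto (fun x : ℝ => x) (𝓝[>] 0) (𝓝 0) :=
  tendsto_id.mono_left nhdsWithin_le_nhds

lemma tendsto_mul_log_half : Tendsto (fun x : ℝ => x * Real.log (x / 2)) (𝓝[>] 0) (𝓝 0) := by
  have h0 := tendsto_log_mul_rpow_nhdsGT_zero one_pos
  simp only [Real.rpow_one] at h0
  have h1 := h0.sub (tendsto_id_zero_right.mul_const (Real.log 2))
  rw [zero_mul, sub_zero] at h1
  refine h1.congr' ?_
  filter_upwards [self_mem_nhdsWithin] with x hx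
  rw [Real.log_div (ne_of_gt hx) two_ne_zero]
  ring

lemma tendsto_besselJ_zero : Tendsto (besselJ 0) (𝓝[>] 0) (𝓝 1) := by
  have := tendsto_seriesJ_comp 0
  rw [show coeffJ 0 0 = 1 by simp [coeffJ]] at this
  exact this.congr fun x => by simp [besselJ_eq]

lemma tendsto_besselJ_one_div : Tendsto (fun x => besselJ 1 x / x) (𝓝[>] 0) (𝓝 (1 / 2)) := by
  have := (tendsto_seriesJ_comp 1).const_mul (1 / 2)
  rw [show coeffJ 1 0 = 1 by simp [coeffJ], mul_one] at this
  refine this.congr' ?_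
  filter_upwards [self_mem_nhdsWithin] with x hx
  have : x ≠ 0 := ne_of_gt hx
  rw [besselJ_eq]
  field_simp

lemma tendsto_besselJ_one : Tendsto (besselJ 1) (𝓝[>] 0) (𝓝 0) := by
  have := tendsto_besselJ_one_div.mul tendsto_id_zero_right
  rw [mul_zero] at this
  refine this.congr' ?_
  filter_upwards [self_mem_nhdsWithin] with x hx
  exact div_mul_cancel₀ _ (ne_of_gt hx)

/-- The slope of J_0 at 0 is -J_1(0) = 0, so J_0 - 1 is o(x), more than enough to beat the
logarithm. -/
lemma tendsto_log_half_mul_besselJ_zero_sub :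
    Tendsto (fun x => Real.log (x / 2) * (besselJ 0 x - 1)) (𝓝[>] 0) (𝓝 0) := by
  have hs : Tendsto (fun x => (besselJ 0 x - 1) / x) (𝓝[>] 0) (𝓝 0) := by
    have h := (hasDerivAt_besselJ_zero 0).tendsto_slope
    have h1 : besselJ 1 0 = 0 := by simp [besselJ_eq]
    have h0 : besselJ 0 0 = 1 := by
      have h2 := (hasDerivAt_besselJ_zero 0).continuousAt.tendsto.mono_left
        (nhdsWithin_le_nhds (s := Ioi 0))
      exact tendsto_nhds_unique h2 tendsto_besselJ_zero
    rw [h1, neg_zero] at h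
    refine (h.mono_left (nhdsWithin_mono _ fun x hx => ne_of_gt hx)).congr fun x => ?_
    rw [slope_def_field, h0, sub_zero]
  have := hs.mul tendsto_mul_log_half
  rw [mul_zero] at this
  refine this.congr' ?_
  filter_upwards [self_mem_nhdsWithin] with x hx
  have : x ≠ 0 := ne_of_gt hx
  field_simp

lemma tendsto_besselY_zero_sub_log :
    Tendsto (fun x => besselY 0 x - 2 / π * (Real.log (x / 2) + Real.eulerMascheroniConstant))
      (𝓝[>] 0) (𝓝 0) := by
  have h := (tendsto_log_half_mul_besselJ_zero_sub.const_mul (2 / π)).sub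
    (((tendsto_seriesY_comp 0).const_mul (1 / π)).add_const
      (2 / π * Real.eulerMascheroniConstant))
  have e : (2 / π) * 0 - (1 / π * coeffY 0 0 + 2 / π * Real.eulerMascheroniConstant) = 0 := by
    simp [coeffY, coeffJ]; ring
  rw [e] at h
  refine h.congr fun x => ?_
  rw [besselY_zero_eq]
  ring

lemma tendsto_mul_besselY_one :
    Tendsto (fun x => x * besselY 1 x) (𝓝[>] 0) (𝓝 (-(2 / π))) := by
  have h1 := (tendsto_mul_log_half.mul tendsto_besselJ_one).const_mul (2 / π)
  have h2 := (((tendsto_id_zero_right.mul tendsto_id_zero_right).mul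
    (tendsto_seriesY_comp 1))).const_mul (1 / (2 * π))
  have h := (h1.sub h2).const_add (-(2 / π))
  simp only [zero_mul, mul_zero, sub_zero, add_zero] at h
  refine h.congr' ?_
  filter_upwards [self_mem_nhdsWithin] with x hx
  have : x ≠ 0 := ne_of_gt hx
  rw [besselY_one_eq]
  field_simp
  ring

lemma tendsto_mul_besselY_zero : Tendsto (fun x => x * besselY 0 x) (𝓝[>] 0) (𝓝 0) := by
  have h := (tendsto_id_zero_right.mul tendsto_besselY_zero_sub_log).add
    ((tendsto_mul_log_half.add
      (tendsto_id_zero_right.mul_const Real.eulerMascheroniConstant)).const_mul (2 / π))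
  simp only [zero_mul, mul_zero, add_zero] at h
  exact h.congr fun x => by ring

/-! ### The function `√(1 + i z²)` -/

/-- The principal square root of `1 + i z²`. -/
def rootA (z : ℝ) : ℂ := (1 + Complex.I * (z : ℂ) ^ 2) ^ (2⁻¹ : ℂ)

lemma rootA_sq (z : ℝ) : rootA z ^ 2 = 1 + Complex.I * (z : ℂ) ^ 2 := by
  have := Complex.cpow_nat_inv_pow (1 + Complex.I * (z : ℂ) ^ 2) two_ne_zero
  rwa [Nat.cast_ofNat] at this

lemma one_add_I_mul_sq_re (z : ℝ) : (1 + Complex.I * (z : ℂ) ^ 2).re = 1 := by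
  simp [← Complex.ofReal_pow]

lemma one_add_I_mul_sq_im (z : ℝ) : (1 + Complex.I * (z : ℂ) ^ 2).im = z ^ 2 := by
  simp [← Complex.ofReal_pow]

/-- The principal root of w has real part √((|w| + Re w)/2), and here |w| ≥ Re w = 1. -/
lemma one_le_rootA_re (z : ℝ) : 1 ≤ (rootA z).re := by
  rw [rootA, Complex.cpow_inv_two_re, Real.one_le_sqrt, one_add_I_mul_sq_re]
  have := Complex.re_le_norm (1 + Complex.I * (z : ℂ) ^ 2)
  rw [one_add_I_mul_sq_re] at this
  linarith

lemma rootA_im_nonneg (z : ℝ) : 0 ≤ (rootA z).im := by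
  rw [rootA, Complex.cpow_inv_two_im_eq_sqrt (by rw [one_add_I_mul_sq_im]; positivity)]
  exact Real.sqrt_nonneg _

lemma one_le_norm_rootA (z : ℝ) : 1 ≤ ‖rootA z‖ :=
  (one_le_rootA_re z).trans (Complex.re_le_norm _)

lemma rootA_ne_zero (z : ℝ) : rootA z ≠ 0 := fun h => by
  have := one_le_norm_rootA z
  rw [h, norm_zero] at this
  linarith

lemma norm_inv_rootA_le (z : ℝ) : ‖(rootA z)⁻¹‖ ≤ 1 := by
  rw [norm_inv]
  exact inv_le_one_of_one_le₀ (one_le_norm_rootA z)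

lemma norm_rootA_le {z : ℝ} (hz : 0 ≤ z) : ‖rootA z‖ ≤ 1 + z := by
  have h : ‖rootA z‖ ^ 2 ≤ 1 + z ^ 2 := by
    rw [← norm_pow, rootA_sq]
    refine (norm_add_le _ _).trans ?_
    simp
  nlinarith [norm_nonneg (rootA z)]

/-- With A = `rootA z`, 1/A - 1 = (1 - A²)/(A (A + 1)), where the numerator is -iz² and both factors
below have modulus at least 1. This supplies the z² that makes the Hankel error smaller by a factor
x. -/
lemma norm_inv_rootA_sub_one_le (z : ℝ) : ‖(rootA z)⁻¹ - 1‖ ≤ z ^ 2 := by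
  have h0 := rootA_ne_zero z
  have h1 : rootA z + 1 ≠ 0 := fun h => by
    have := congrArg Complex.re h
    have h2 := one_le_rootA_re z
    simp at this
    linarith
  have h2 : 1 ≤ ‖rootA z + 1‖ := by
    refine le_trans ?_ (Complex.re_le_norm _)
    simpa using (zero_le_one.trans (one_le_rootA_re z))
  have e : (rootA z)⁻¹ - 1 = -(Complex.I * (z : ℂ) ^ 2 * (rootA z)⁻¹ * (rootA z + 1)⁻¹) := by
    have h3 := rootA_sq z
    field_simp
    linear_combination -h3
  rw [e, norm_neg, norm_mul, norm_mul, norm_mul, Complex.norm_I, norm_pow, Complex.norm_real,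
    norm_inv (rootA z + 1), one_mul, Real.norm_eq_abs, sq_abs]
  have h3 := norm_inv_rootA_le z
  have h4 := inv_le_one_of_one_le₀ h2
  calc z ^ 2 * ‖(rootA z)⁻¹‖ * ‖rootA z + 1‖⁻¹ ≤ z ^ 2 * 1 * 1 := by gcongr
    _ = z ^ 2 := by ring

lemma hasDerivAt_rootA (z : ℝ) : HasDerivAt rootA (Complex.I * z / rootA z) z := by
  have h1 : HasDerivAt (fun w : ℂ => 1 + Complex.I * w ^ 2) (Complex.I * (2 * z)) (z : ℂ) := by
    have := ((hasDerivAt_pow 2 (z : ℂ)).const_mul Complex.I).const_add 1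
    simpa using this
  have hs : 1 + Complex.I * (z : ℂ) ^ 2 ∈ Complex.slitPlane :=
    Or.inl (by rw [one_add_I_mul_sq_re]; norm_num)
  have h2 := (h1.cpow_const (c := 2⁻¹) hs).comp_ofReal
  refine h2.congr_deriv ?_
  have hne : 1 + Complex.I * (z : ℂ) ^ 2 ≠ 0 := Complex.slitPlane_ne_zero hs
  have h3 := rootA_ne_zero z
  have e : (1 + Complex.I * (z : ℂ) ^ 2) ^ (2⁻¹ - 1 : ℂ) = 1 / rootA z := by
    rw [Complex.cpow_sub _ _ hne, Complex.cpow_one]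
    change rootA z / _ = _
    rw [← rootA_sq z]
    field_simp
  rw [e]
  field_simp

lemma continuous_rootA : Continuous rootA :=
  continuous_iff_continuousAt.2 fun z => (hasDerivAt_rootA z).continuousAt

/-! ### Gaussian moments against `1 / √(1 + i z²)` -/

lemma integrableOn_pow_mul_gauss {x : ℝ} (hx : 0 < x) (k : ℕ) :
    IntegrableOn (fun z : ℝ => z ^ k * Real.exp (-(2 * x) * z ^ 2)) (Ioi 0) := by
  have := integrableOn_rpow_mul_exp_neg_mul_sq (b := 2 * x) (by positivity) (s := k)
    (by have := k.cast_nonneg (α := ℝ); linarith)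
  simpa using this

/-- The integrand of `momentA`. -/
def momentIntegrand (k : ℕ) (x z : ℝ) : ℂ :=
  ((z ^ (2 * k) * Real.exp (-(2 * x) * z ^ 2) : ℝ) : ℂ) * (rootA z)⁻¹

/-- `∫₀^∞ z ^ (2 k) e^{-2 x z²} / √(1 + i z²) dz`. -/
def momentA (k : ℕ) (x : ℝ) : ℂ := ∫ z in Ioi (0 : ℝ), momentIntegrand k x z

lemma continuous_momentIntegrand (k : ℕ) (x : ℝ) : Continuous (momentIntegrand k x) := by
  have := continuous_rootA.inv₀ rootA_ne_zero
  exact (by fun_prop : Continuous fun z : ℝ =>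
    ((z ^ (2 * k) * Real.exp (-(2 * x) * z ^ 2) : ℝ) : ℂ)).mul this

lemma norm_momentIntegrand_le (k : ℕ) (x z : ℝ) :
    ‖momentIntegrand k x z‖ ≤ z ^ (2 * k) * Real.exp (-(2 * x) * z ^ 2) := by
  have h : 0 ≤ z ^ (2 * k) * Real.exp (-(2 * x) * z ^ 2) := by
    rw [pow_mul]; positivity
  rw [momentIntegrand, norm_mul, Complex.norm_real, Real.norm_of_nonneg h]
  exact mul_le_of_le_one_right h (norm_inv_rootA_le z)

lemma integrableOn_momentIntegrand (k : ℕ) {x : ℝ} (hx : 0 < x) :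
    IntegrableOn (momentIntegrand k x) (Ioi 0) :=
  (integrableOn_pow_mul_gauss hx (2 * k)).mono' (continuous_momentIntegrand k x).aestronglyMeasurable
    (Eventually.of_forall (norm_momentIntegrand_le k x))

lemma hasDerivAt_momentA (k : ℕ) {x : ℝ} (hx : 0 < x) :
    HasDerivAt (momentA k) (-2 * momentA (k + 1) x) x := by
  have h := hasDerivAt_integral_of_dominated_loc_of_deriv_le (𝕜 := ℝ)
    (μ := volume.restrict (Ioi (0 : ℝ))) (F := fun x z => momentIntegrand k x z)
    -- On parameters above x/2, the Gaussian with parameter x/2 dominates all the derivatives at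
    -- once.
    (F' := fun x z => -2 * momentIntegrand (k + 1) x z) (x₀ := x) (s := Ioi (x / 2))
    (bound := fun z => 2 * (z ^ (2 * (k + 1)) * Real.exp (-(2 * (x / 2)) * z ^ 2)))
    (Ioi_mem_nhds (by linarith))
    (Eventually.of_forall fun y => (continuous_momentIntegrand k y).aestronglyMeasurable)
    (integrableOn_momentIntegrand k hx)
    ((continuous_momentIntegrand (k + 1) x).const_mul _ |>.aestronglyMeasurable)
    (Eventually.of_forall fun z y hy => by
      rw [norm_mul, norm_neg, Complex.norm_ofNat]
      refine mul_le_mul_of_nonneg_left ((norm_momentIntegrand_le _ _ _).trans ?_) zero_le_two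
      have hy : x / 2 ≤ y := le_of_lt hy
      have : 0 ≤ z ^ (2 * (k + 1)) := by rw [pow_mul]; positivity
      refine mul_le_mul_of_nonneg_left (Real.exp_le_exp.2 ?_) this
      nlinarith [sq_nonneg z])
    ((integrableOn_pow_mul_gauss (by positivity) _).const_mul 2)
    (Eventually.of_forall fun z y _ => by
      have h1 : HasDerivAt (fun y : ℝ => z ^ (2 * k) * Real.exp (-(2 * y) * z ^ 2))
          (-2 * (z ^ (2 * (k + 1)) * Real.exp (-(2 * y) * z ^ 2))) y := by
        have := (((((hasDerivAt_id y).const_mul 2).neg).mul_const (z ^ 2)).exp).const_mul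
          (z ^ (2 * k))
        refine this.congr_deriv ?_
        simp
        ring
      refine (h1.ofReal_comp.mul_const (rootA z)⁻¹).congr_deriv ?_
      simp only [momentIntegrand]
      push_cast
      ring)
  refine h.2.congr_deriv ?_
  rw [momentA, integral_const_mul]

lemma tendsto_pow_mul_gauss {x : ℝ} (hx : 0 < x) (k : ℕ) :
    Tendsto (fun z : ℝ => z ^ k * Real.exp (-(2 * x) * z ^ 2)) atTop (𝓝 0) := by
  have h := (rpow_mul_exp_neg_mul_sq_isLittleO_exp_neg (b := 2 * x) (by positivity) k).trans_tendsto
    (Real.tendsto_exp_atBot.comp (tendsto_id.const_mul_atTop_of_neg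
      (by norm_num : (-(1 / 2) : ℝ) < 0)))
  simpa using h

lemma tendsto_zero_of_norm_le_gauss {x : ℝ} (hx : 0 < x) {f : ℝ → ℂ} {a b : ℝ}
    (hf : ∀ z, 0 ≤ z → ‖f z‖ ≤ (a * z + b * z ^ 2) * Real.exp (-(2 * x) * z ^ 2)) :
    Tendsto f atTop (𝓝 0) := by
  have h := ((tendsto_pow_mul_gauss hx 1).const_mul a).add
    ((tendsto_pow_mul_gauss hx 2).const_mul b)
  simp only [mul_zero, add_zero] at h
  refine squeeze_zero_norm' ?_ h
  filter_upwards [eventually_ge_atTop 0] with z hz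
  exact (hf z hz).trans_eq (by ring)

lemma hasDerivAt_gauss (x z : ℝ) :
    HasDerivAt (fun z : ℝ => ((Real.exp (-(2 * x) * z ^ 2) : ℝ) : ℂ))
      (-(4 * x * z) * (Real.exp (-(2 * x) * z ^ 2) : ℝ)) z := by
  have := (((hasDerivAt_pow 2 z).const_mul (-(2 * x))).exp).ofReal_comp
  refine this.congr_deriv ?_
  push_cast
  ring

/-- Integrate the derivative of z √(1 + iz²) e^{-2xz²} over (0, ∞); the boundary terms vanish. This
is Bessel's equation for the integral representation, in terms of moments. -/
lemma momentA_relation {x : ℝ} (hx : 0 < x) :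
    momentA 0 x + 2 * Complex.I * momentA 1 x - 4 * x * momentA 1 x
      - 4 * Complex.I * x * momentA 2 x = 0 := by
  have hd : ∀ z ∈ Ici (0 : ℝ), HasDerivAt
      (fun z : ℝ => ((Real.exp (-(2 * x) * z ^ 2) : ℝ) : ℂ) * ((z : ℂ) * rootA z))
      (momentIntegrand 0 x z + 2 * Complex.I * momentIntegrand 1 x z
        - 4 * x * momentIntegrand 1 x z - 4 * Complex.I * x * momentIntegrand 2 x z) z := by
    intro z _
    have h := (hasDerivAt_gauss x z).mul
      (((hasDerivAt_id z).ofReal_comp).mul (hasDerivAt_rootA z))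
    refine h.congr_deriv ?_
    have h1 := rootA_sq z
    have h0 := rootA_ne_zero z
    simp only [momentIntegrand, id, Pi.mul_apply]
    push_cast
    field_simp
    rw [h1]
    ring
  have i0 := integrableOn_momentIntegrand 0 hx
  have i1 := integrableOn_momentIntegrand 1 hx
  have i2 := integrableOn_momentIntegrand 2 hx
  have h := integral_Ioi_of_hasDerivAt_of_tendsto' hd
    (((i0.add (i1.const_mul _)).sub (i1.const_mul _)).sub (i2.const_mul _))
    (tendsto_zero_of_norm_le_gauss (a := 1) (b := 1) hx fun z hz => by
      rw [norm_mul, norm_mul, Complex.norm_real, Complex.norm_real, Real.norm_of_nonneg hz,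
        Real.norm_of_nonneg (Real.exp_nonneg _), mul_comm]
      refine mul_le_mul_of_nonneg_right ?_ (Real.exp_nonneg _)
      calc z * ‖rootA z‖ ≤ z * (1 + z) := by gcongr; exact norm_rootA_le hz
        _ = _ := by ring)
  rw [integral_sub, integral_sub, integral_add] at h
  · simp only [integral_const_mul] at h
    simpa [momentA] using h
  · exact i0
  · exact i1.const_mul _
  · exact i0.add (i1.const_mul _)
  · exact i1.const_mul _
  · exact (i0.add (i1.const_mul _)).sub (i1.const_mul _)
  · exact i2.const_mul _

/-- By scaling, the second moment is a constant times x^{-3/2}; it is written as the Bessel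
amplitude divided by x, the form in which errors are stated later. -/
lemma exists_gauss_sq_bound :
    ∃ C : ℝ, 0 ≤ C ∧ ∀ x : ℝ, 0 < x →
      ∫ z in Ioi (0 : ℝ), z ^ 2 * Real.exp (-(2 * x) * z ^ 2) = C * (√(2 / (π * x)) / x) := by
  refine ⟨√π * 2 ^ (-(3 / 2) : ℝ) * (1 / 2) * Real.Gamma (3 / 2) / √2, ?_, fun x hx => ?_⟩
  · have := Real.Gamma_pos_of_pos (by norm_num : (0 : ℝ) < 3 / 2)
    positivity
  have h := integral_rpow_mul_exp_neg_mul_rpow (p := 2) (q := 2) (b := 2 * x) two_pos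
    (by norm_num) (by positivity)
  simp only [Real.rpow_two] at h
  rw [h, Real.mul_rpow zero_le_two hx.le, Real.sqrt_div zero_le_two, Real.sqrt_mul pi_nonneg]
  have e : x ^ (-(2 + 1) / 2 : ℝ) = 1 / (√x * x) := by
    rw [show (-(2 + 1) / 2 : ℝ) = -(1 / 2 + 1) by norm_num, Real.rpow_neg hx.le,
      Real.rpow_add hx, Real.rpow_one, ← Real.sqrt_eq_rpow, one_div]
  rw [e, show (-(2 + 1) / 2 : ℝ) = -(3 / 2) by norm_num, show ((2 : ℝ) + 1) / 2 = 3 / 2 by norm_num]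
  have := Real.sqrt_pos.2 hx
  have := Real.sqrt_pos.2 pi_pos
  field_simp

lemma norm_momentA_one_le {x : ℝ} (hx : 0 < x) :
    ‖momentA 1 x‖ ≤ ∫ z in Ioi (0 : ℝ), z ^ 2 * Real.exp (-(2 * x) * z ^ 2) :=
  norm_integral_le_of_norm_le (integrableOn_pow_mul_gauss hx 2)
    (Eventually.of_forall (norm_momentIntegrand_le 1 x))

lemma norm_momentA_zero_sub_le {x : ℝ} (hx : 0 < x) :
    ‖momentA 0 x - (π / 4 * √(2 / (π * x)) : ℝ)‖ ≤
      ∫ z in Ioi (0 : ℝ), z ^ 2 * Real.exp (-(2 * x) * z ^ 2) := by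
  have e : π / 4 * √(2 / (π * x)) = ∫ z in Ioi (0 : ℝ), Real.exp (-(2 * x) * z ^ 2) := by
    rw [integral_gaussian_Ioi, show (2 : ℝ) / (π * x) = (2 / π) ^ 2 * (π / (2 * x)) by
      field_simp, Real.sqrt_mul (by positivity), Real.sqrt_sq (by positivity)]
    field_simp
    norm_num
  have hi : IntegrableOn (fun z : ℝ => ((Real.exp (-(2 * x) * z ^ 2) : ℝ) : ℂ)) (Ioi 0) := by
    have := (integrableOn_pow_mul_gauss hx 0).ofReal (𝕜 := ℂ)
    simp only [pow_zero, one_mul] at this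
    exact this
  rw [e, ← integral_complex_ofReal, momentA,
    ← integral_sub (integrableOn_momentIntegrand 0 hx) hi]
  refine norm_integral_le_of_norm_le (integrableOn_pow_mul_gauss hx 2)
    (Eventually.of_forall fun z => ?_)
  have e1 : momentIntegrand 0 x z - ((Real.exp (-(2 * x) * z ^ 2) : ℝ) : ℂ) =
      ((Real.exp (-(2 * x) * z ^ 2) : ℝ) : ℂ) * ((rootA z)⁻¹ - 1) := by
    simp only [momentIntegrand, mul_zero, pow_zero, one_mul]
    ring
  rw [e1, norm_mul, Complex.norm_real, Real.norm_of_nonneg (Real.exp_nonneg _), mul_comm]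
  exact mul_le_mul_of_nonneg_right (norm_inv_rootA_sub_one_le z) (Real.exp_nonneg _)

/-! ### The Hankel integrals -/

/-- The phase factor `(4 / π) e^{i (x - π/4)}`. -/
def hankelPhase (x : ℝ) : ℂ := 4 / π * Complex.exp (Complex.I * ((x - π / 4 : ℝ) : ℂ))

/-- The integral that represents `H_0^{(1)}`. -/
def hankelInt0 (x : ℝ) : ℂ := hankelPhase x * momentA 0 x

/-- The integral that represents `H_1^{(1)}`. -/
def hankelInt1 (x : ℝ) : ℂ := -(hankelPhase x * (Complex.I * momentA 0 x - 2 * momentA 1 x))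

lemma hasDerivAt_hankelPhase (x : ℝ) :
    HasDerivAt hankelPhase (Complex.I * hankelPhase x) x := by
  have h := (((((hasDerivAt_id x).sub_const (π / 4)).ofReal_comp).const_mul Complex.I).cexp).const_mul
    (4 / (π : ℂ))
  refine h.congr_deriv ?_
  simp only [hankelPhase, id, Complex.ofReal_one]
  ring

lemma norm_hankelPhase (x : ℝ) : ‖hankelPhase x‖ = 4 / π := by
  rw [hankelPhase, norm_mul, mul_comm Complex.I, Complex.norm_exp_ofReal_mul_I, mul_one, norm_div,
    Complex.norm_real, Real.norm_of_nonneg pi_nonneg, Complex.norm_ofNat]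

lemma hasDerivAt_hankelInt0 {x : ℝ} (hx : 0 < x) :
    HasDerivAt hankelInt0 (-hankelInt1 x) x := by
  refine ((hasDerivAt_hankelPhase x).mul (hasDerivAt_momentA 0 hx)).congr_deriv ?_
  simp only [hankelInt1]
  ring

/-- After the product rule, what remains is a multiple of `momentA_relation`. -/
lemma hasDerivAt_mul_hankelInt1 {x : ℝ} (hx : 0 < x) :
    HasDerivAt (fun x : ℝ => (x : ℂ) * hankelInt1 x) (x * hankelInt0 x) x := by
  have h := ((hasDerivAt_id x).ofReal_comp).mul (((hasDerivAt_hankelPhase x).mul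
    (((hasDerivAt_momentA 0 hx).const_mul Complex.I).sub
      ((hasDerivAt_momentA 1 hx).const_mul 2))).neg)
  refine h.congr_deriv ?_
  have hr := momentA_relation hx
  simp only [hankelInt0, id, Complex.ofReal_one, Pi.mul_apply, Pi.neg_apply, Pi.sub_apply, zero_add,
    one_add_one_eq_two]
  linear_combination (-hankelPhase x * Complex.I) * hr + (hankelPhase x * (2 * momentA 1 x
    - x * momentA 0 x - 4 * x * momentA 2 x)) * Complex.I_sq

lemma exists_hankelInt0_bound : ∃ C : ℝ, 0 ≤ C ∧ ∀ x : ℝ, 0 < x →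
    ‖hankelInt0 x - √(2 / (π * x)) * Complex.exp (Complex.I * ((x - π / 4 : ℝ) : ℂ))‖ ≤
      C * (√(2 / (π * x)) / x) := by
  obtain ⟨C, hC, h⟩ := exists_gauss_sq_bound
  refine ⟨4 / π * C, by positivity, fun x hx => ?_⟩
  have e : hankelInt0 x - √(2 / (π * x)) * Complex.exp (Complex.I * ((x - π / 4 : ℝ) : ℂ)) =
      hankelPhase x * (momentA 0 x - (π / 4 * √(2 / (π * x)) : ℝ)) := by
    simp only [hankelInt0, hankelPhase]
    have := Complex.ofReal_ne_zero.2 pi_ne_zero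
    push_cast
    field_simp
  rw [e, norm_mul, norm_hankelPhase, mul_assoc, ← h x hx]
  gcongr
  exact norm_momentA_zero_sub_le hx

lemma exists_hankelInt1_bound : ∃ C : ℝ, 0 ≤ C ∧ ∀ x : ℝ, 0 < x →
    ‖hankelInt1 x - √(2 / (π * x)) * Complex.exp (Complex.I * ((x - π / 2 - π / 4 : ℝ) : ℂ))‖ ≤
      C * (√(2 / (π * x)) / x) := by
  obtain ⟨C, hC, h⟩ := exists_gauss_sq_bound
  -- One C comes from the error in `momentA 0`, two from 2 * `momentA 1`, which contributes only to
  -- the error.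
  refine ⟨4 / π * (3 * C), by positivity, fun x hx => ?_⟩
  have e : hankelInt1 x - √(2 / (π * x)) * Complex.exp (Complex.I * ((x - π / 2 - π / 4 : ℝ) : ℂ))
      = -(hankelPhase x * (Complex.I * (momentA 0 x - (π / 4 * √(2 / (π * x)) : ℝ))
        - 2 * momentA 1 x)) := by
    have e1 : Complex.exp (Complex.I * ((x - π / 2 - π / 4 : ℝ) : ℂ)) =
        -Complex.I * Complex.exp (Complex.I * ((x - π / 4 : ℝ) : ℂ)) := by
      rw [← Complex.exp_neg_pi_div_two_mul_I, ← Complex.exp_add]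
      congr 1
      push_cast
      ring
    rw [e1]
    simp only [hankelInt1, hankelPhase]
    have := Complex.ofReal_ne_zero.2 pi_ne_zero
    push_cast
    field_simp
    ring
  rw [e, norm_neg, norm_mul, norm_hankelPhase, mul_assoc, mul_assoc 3, ← h x hx]
  gcongr
  refine (norm_sub_le _ _).trans ?_
  rw [norm_mul, norm_mul, Complex.norm_I, Complex.norm_ofNat]
  linarith [norm_momentA_zero_sub_le hx, norm_momentA_one_le hx]

/-! ### Behaviour of the Hankel integral at the origin -/

/-- `e^{iπ/4}`. -/
def cisQuarter : ℂ := Complex.exp ((π / 4 : ℝ) * Complex.I)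

lemma cisQuarter_sq : cisQuarter ^ 2 = Complex.I := by
  conv_rhs => rw [← Complex.exp_pi_div_two_mul_I]
  rw [cisQuarter, ← Complex.exp_nat_mul]
  congr 1
  push_cast
  ring

lemma norm_cisQuarter : ‖cisQuarter‖ = 1 := Complex.norm_exp_ofReal_mul_I _

lemma cisQuarter_ne_zero : cisQuarter ≠ 0 := Complex.exp_ne_zero _

lemma cisQuarter_re : cisQuarter.re = √2 / 2 := by
  rw [cisQuarter, Complex.exp_ofReal_mul_I_re, Real.cos_pi_div_four]

lemma cisQuarter_im : cisQuarter.im = √2 / 2 := by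
  rw [cisQuarter, Complex.exp_ofReal_mul_I_im, Real.sin_pi_div_four]

/-- `z + e^{-iπ/4} √(1 + i z²)`, the exponential of an antiderivative of
`e^{iπ/4} / √(1 + i z²)`. -/
def arsinhArg (z : ℝ) : ℂ := z + rootA z / cisQuarter

/-- An antiderivative of `e^{iπ/4} / √(1 + i z²)`. -/
def arsinhLog (z : ℝ) : ℂ := Complex.log (arsinhArg z)

/-- `rootA z` lies in the closed first quadrant off the origin, and turning it by -π/4 keeps it in
the open right half-plane. Hence for z ≥ 0 the logarithm `arsinhLog` never meets its branch cut. -/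
lemma rootA_div_cisQuarter_re_pos (z : ℝ) : 0 < (rootA z / cisQuarter).re := by
  have h1 := one_le_rootA_re z
  have h2 := rootA_im_nonneg z
  have h3 : 0 < √2 := by positivity
  rw [Complex.div_re, Complex.normSq_eq_norm_sq, norm_cisQuarter, cisQuarter_re, cisQuarter_im]
  simp only [one_pow, div_one]
  nlinarith [mul_nonneg h2 h3.le]

lemma lt_arsinhArg_re (z : ℝ) : z < (arsinhArg z).re := by
  have := rootA_div_cisQuarter_re_pos z
  rw [arsinhArg, Complex.add_re, Complex.ofReal_re]
  linarith

lemma arsinhArg_mem_slitPlane {z : ℝ} (hz : 0 ≤ z) : arsinhArg z ∈ Complex.slitPlane :=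
  Or.inl (hz.trans_lt (lt_arsinhArg_re z))

lemma arsinhArg_ne_zero {z : ℝ} (hz : 0 ≤ z) : arsinhArg z ≠ 0 :=
  Complex.slitPlane_ne_zero (arsinhArg_mem_slitPlane hz)

lemma norm_arsinhArg_le {z : ℝ} (hz : 0 ≤ z) : ‖arsinhArg z‖ ≤ 1 + 2 * z := by
  refine (norm_add_le _ _).trans ?_
  rw [norm_div, norm_cisQuarter, div_one, Complex.norm_real, Real.norm_of_nonneg hz]
  linarith [norm_rootA_le hz]

/-- A difference of squares. Since the first factor grows, the second tends to 0, which gives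
`arsinhArg z` ~ 2z. -/
lemma arsinhArg_mul (z : ℝ) : arsinhArg z * (rootA z / cisQuarter - z) = -Complex.I := by
  have h1 := rootA_sq z
  have h2 := cisQuarter_sq
  have h3 := cisQuarter_ne_zero
  have : arsinhArg z * (rootA z / cisQuarter - z) = rootA z ^ 2 / cisQuarter ^ 2 - z ^ 2 := by
    rw [arsinhArg]
    field_simp
    ring
  rw [this, h1, h2]
  field_simp
  rw [Complex.I_sq]
  ring

lemma hasDerivAt_arsinhLog {z : ℝ} (hz : 0 ≤ z) :
    HasDerivAt arsinhLog (cisQuarter * (rootA z)⁻¹) z := by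
  have h := ((hasDerivAt_id z).ofReal_comp.add ((hasDerivAt_rootA z).div_const cisQuarter)).clog_real
    (arsinhArg_mem_slitPlane hz)
  refine h.congr_deriv ?_
  have h0 := arsinhArg_ne_zero hz
  change _ / arsinhArg z = _
  rw [div_eq_iff h0]
  have h1 := rootA_ne_zero z
  have h2 := cisQuarter_sq
  have h3 := cisQuarter_ne_zero
  rw [arsinhArg, Complex.ofReal_one]
  field_simp
  linear_combination (-z : ℂ) * h2

lemma arsinhLog_zero : arsinhLog 0 = ((-(π / 4) : ℝ) : ℂ) * Complex.I := by
  have e : rootA 0 = 1 := by simp [rootA]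
  rw [arsinhLog, arsinhArg, e, cisQuarter, Complex.ofReal_zero, zero_add, one_div, ← Complex.exp_neg,
    ← neg_mul, ← Complex.ofReal_neg, Complex.log_exp]
  · simp; linarith [pi_pos]
  · simp; linarith [pi_pos]

lemma norm_clog_le {w : ℂ} {b : ℝ} (h1 : Real.log ‖w‖ ≤ b) (h2 : -b ≤ Real.log ‖w‖) :
    ‖Complex.log w‖ ≤ b + π := by
  refine (Complex.norm_le_abs_re_add_abs_im _).trans ?_
  rw [Complex.log_re, Complex.log_im]
  exact add_le_add (abs_le.2 ⟨h2, h1⟩) (Complex.abs_arg_le_pi w)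

/-- `arsinhLog z - log (2 z)`, as a single logarithm. -/
def arsinhErr (z : ℝ) : ℂ := Complex.log (arsinhArg z / (2 * z))

lemma arsinhLog_eq {z : ℝ} (hz : 0 < z) :
    arsinhLog z = ((Real.log 2 + Real.log z : ℝ) : ℂ) + arsinhErr z := by
  have hz' : (z : ℂ) ≠ 0 := Complex.ofReal_ne_zero.2 hz.ne'
  rw [arsinhErr, ← Real.log_mul two_ne_zero hz.ne', ← Complex.log_ofReal_mul (by positivity)
    (div_ne_zero (arsinhArg_ne_zero hz.le) (by simp [hz'])), arsinhLog]
  congr 1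
  push_cast
  field_simp

/-- The crude 1/z is harmless: after the substitution v = 2xz² it becomes v^{-1/2}, which is
integrable against e^{-v}. -/
lemma norm_arsinhErr_le {z : ℝ} (hz : 0 < z) : ‖arsinhErr z‖ ≤ 5 + 1 / z := by
  have hn : ‖arsinhArg z / (2 * z)‖ = ‖arsinhArg z‖ / (2 * z) := by
    rw [norm_div, norm_mul, Complex.norm_ofNat, Complex.norm_real, Real.norm_of_nonneg hz.le]
  have h1 : z ≤ ‖arsinhArg z‖ := (lt_arsinhArg_re z).le.trans (Complex.re_le_norm _)
  have h2 := norm_arsinhArg_le hz.le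
  have hlow : 1 / 2 ≤ ‖arsinhArg z‖ / (2 * z) := by
    rw [div_le_div_iff₀ two_pos (by positivity)]
    linarith
  have hup : ‖arsinhArg z‖ / (2 * z) ≤ 1 + 1 / z := by
    rw [div_le_iff₀ (by positivity)]
    field_simp
    linarith
  have hpi := pi_lt_four
  refine (norm_clog_le (b := 1 + 1 / z) ?_ ?_).trans (by linarith)
  · rw [hn]
    linarith [Real.log_le_sub_one_of_pos (by linarith : 0 < ‖arsinhArg z‖ / (2 * z))]
  · rw [hn]
    have h3 := Real.log_le_log (by norm_num) hlow
    rw [one_div, Real.log_inv] at h3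
    have := Real.log_two_lt_d9
    have : 0 < 1 / z := by positivity
    linarith

lemma tendsto_arsinhErr : Tendsto arsinhErr atTop (𝓝 0) := by
  have h : Tendsto (fun z : ℝ => arsinhArg z / (2 * z)) atTop (𝓝 1) := by
    rw [tendsto_iff_norm_sub_tendsto_zero]
    refine squeeze_zero_norm' (a := fun z : ℝ => z⁻¹) ?_ tendsto_inv_atTop_zero
    filter_upwards [eventually_ge_atTop 1] with z hz
    have hz0 : 0 < z := by linarith
    have hz' : (z : ℂ) ≠ 0 := Complex.ofReal_ne_zero.2 hz0.ne'
    have h1 : z ≤ ‖arsinhArg z‖ := (lt_arsinhArg_re z).le.trans (Complex.re_le_norm _)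
    have e : arsinhArg z / (2 * z) - 1 = (rootA z / cisQuarter - z) / (2 * z) := by
      rw [arsinhArg]
      field_simp
      ring
    have h2 := congrArg norm (arsinhArg_mul z)
    rw [norm_mul, norm_neg, Complex.norm_I] at h2
    have h3 : ‖rootA z / cisQuarter - z‖ ≤ 1 := by
      nlinarith [norm_nonneg (rootA z / cisQuarter - z)]
    rw [norm_norm, e, norm_div, norm_mul, Complex.norm_ofNat, Complex.norm_real,
      Real.norm_of_nonneg hz0.le, div_le_iff₀ (by positivity)]
    have : z⁻¹ * (2 * z) = 2 := by field_simp
    linarith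
  have := ((continuousAt_clog Complex.one_mem_slitPlane).tendsto.comp h)
  rwa [Complex.log_one] at this

lemma norm_arsinhLog_sub_le {z : ℝ} (hz : 0 ≤ z) :
    ‖arsinhLog z - arsinhLog 0‖ ≤ z := by
  have := Convex.norm_image_sub_le_of_norm_hasDerivWithin_le (f := arsinhLog) (s := Ici 0) (C := 1)
    (x := 0) (y := z) (fun y hy => (hasDerivAt_arsinhLog hy).hasDerivWithinAt)
    (fun y _ => by
      rw [norm_mul, norm_cisQuarter, one_mul]
      exact norm_inv_rootA_le y) (convex_Ici 0) self_mem_Ici hz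
  simpa [abs_of_nonneg hz] using this

lemma continuousOn_arsinhLog : ContinuousOn arsinhLog (Ici 0) :=
  fun _ hz => (hasDerivAt_arsinhLog hz).continuousAt.continuousWithinAt

/-- Integration by parts with the antiderivative `arsinhLog`, normalised to vanish at 0 so that no
boundary term survives. The small-x logarithm of the moment now sits in the growth of `arsinhLog`.
-/
lemma cisQuarter_mul_momentA_zero {x : ℝ} (hx : 0 < x) :
    cisQuarter * momentA 0 x =
      ∫ z in Ioi (0 : ℝ), ((4 * x * z * Real.exp (-(2 * x) * z ^ 2) : ℝ) : ℂ) *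
        (arsinhLog z - arsinhLog 0) := by
  have i1 : IntegrableOn (fun z => cisQuarter * momentIntegrand 0 x z) (Ioi 0) :=
    (integrableOn_momentIntegrand 0 hx).const_mul _
  have i2 : IntegrableOn (fun z : ℝ => ((4 * x * z * Real.exp (-(2 * x) * z ^ 2) : ℝ) : ℂ) *
      (arsinhLog z - arsinhLog 0)) (Ioi 0) := by
    refine ((integrableOn_pow_mul_gauss hx 2).const_mul (4 * x)).mono' ?_ ?_
    · refine ContinuousOn.aestronglyMeasurable ?_ measurableSet_Ioi
      exact (by fun_prop : Continuous fun z : ℝ =>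
        ((4 * x * z * Real.exp (-(2 * x) * z ^ 2) : ℝ) : ℂ)).continuousOn.mul
        ((continuousOn_arsinhLog.mono Ioi_subset_Ici_self).sub continuousOn_const)
    · refine (ae_restrict_iff' measurableSet_Ioi).2 (Eventually.of_forall fun z hz => ?_)
      have hz : 0 < z := hz
      rw [norm_mul, Complex.norm_real, Real.norm_of_nonneg (by positivity)]
      calc _ ≤ 4 * x * z * Real.exp (-(2 * x) * z ^ 2) * z := by
            gcongr; exact norm_arsinhLog_sub_le hz.le
        _ = _ := by ring
  have hd : ∀ z ∈ Ici (0 : ℝ), HasDerivAt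
      (fun z : ℝ => ((Real.exp (-(2 * x) * z ^ 2) : ℝ) : ℂ) * (arsinhLog z - arsinhLog 0))
      (cisQuarter * momentIntegrand 0 x z - ((4 * x * z * Real.exp (-(2 * x) * z ^ 2) : ℝ) : ℂ) *
        (arsinhLog z - arsinhLog 0)) z := by
    intro z hz
    refine ((hasDerivAt_gauss x z).mul ((hasDerivAt_arsinhLog hz).sub_const _)).congr_deriv ?_
    simp only [momentIntegrand]
    push_cast
    ring
  have h := integral_Ioi_of_hasDerivAt_of_tendsto' hd (i1.sub i2)
    (tendsto_zero_of_norm_le_gauss (a := 1) (b := 0) hx fun z hz => by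
      rw [norm_mul, Complex.norm_real, Real.norm_of_nonneg (Real.exp_nonneg _), mul_comm]
      refine mul_le_mul_of_nonneg_right ?_ (Real.exp_nonneg _)
      linarith [norm_arsinhLog_sub_le hz])
  rw [integral_sub i1 i2, integral_const_mul] at h
  simp only [sub_self, mul_zero] at h
  exact sub_eq_zero.1 h

/-- The substitution v = 2xz², which turns the x-dependent Gaussian weight into e^{-v} and moves x
into the argument of K. -/
lemma integral_gauss_substitution {x : ℝ} (hx : 0 < x) (K : ℝ → ℂ) :
    ∫ z in Ioi (0 : ℝ), ((4 * x * z * Real.exp (-(2 * x) * z ^ 2) : ℝ) : ℂ) * K z =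
      ∫ v in Ioi (0 : ℝ), ((Real.exp (-v) : ℝ) : ℂ) * K (√(v / (2 * x))) := by
  have h1 := integral_comp_rpow_Ioi_of_pos (p := 2) two_pos
    (g := fun u : ℝ => ((2 * x * Real.exp (-(2 * x) * u) : ℝ) : ℂ) * K (√u))
  have h2 := integral_comp_mul_left_Ioi
    (fun v : ℝ => ((Real.exp (-v) : ℝ) : ℂ) * K (√(v / (2 * x)))) 0 (b := 2 * x) (by positivity)
  rw [mul_zero] at h2
  have h3 : ∫ v in Ioi (0 : ℝ), ((Real.exp (-v) : ℝ) : ℂ) * K (√(v / (2 * x))) =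
      ∫ u in Ioi (0 : ℝ), ((2 * x * Real.exp (-(2 * x) * u) : ℝ) : ℂ) * K (√u) := by
    rw [(inv_smul_eq_iff₀ (by positivity : 2 * x ≠ 0)).1 h2.symm, ← integral_smul]
    refine integral_congr_ae (Eventually.of_forall fun u => ?_)
    have e : 2 * x * u / (2 * x) = u := by field_simp
    simp only [e, Complex.real_smul]
    push_cast
    ring_nf
  rw [h3, ← h1]
  refine setIntegral_congr_fun measurableSet_Ioi fun z hz => ?_
  have hz : 0 < z := hz
  simp only [Real.rpow_two, Real.sqrt_sq hz.le, Complex.real_smul]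
  rw [show (2 : ℝ) - 1 = 1 by norm_num, Real.rpow_one]
  push_cast
  ring

lemma integrableOn_exp_neg : IntegrableOn (fun v : ℝ => Real.exp (-v)) (Ioi 0) := by
  simpa using Real.GammaIntegral_convergent one_pos

/-- This is Γ'(1) = -γ, with Γ differentiated under its integral. -/
lemma integral_exp_neg_mul_log :
    ∫ v in Ioi (0 : ℝ), Real.exp (-v) * Real.log v = -Real.eulerMascheroniConstant := by
  have h1 := Complex.hasDerivAt_GammaIntegral (s := 1) (by simp)
  have h2 : HasDerivAt Complex.GammaIntegral (-(Real.eulerMascheroniConstant : ℂ)) 1 := by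
    refine Complex.hasDerivAt_Gamma_one.congr_of_eventuallyEq ?_
    have : ∀ᶠ s : ℂ in 𝓝 1, 0 < s.re :=
      Complex.continuous_re.continuousAt.eventually (lt_mem_nhds (by simp))
    filter_upwards [this] with s hs
    exact (Complex.Gamma_eq_integral hs).symm
  have h3 := h1.unique h2
  have h4 : ∫ v in Ioi (0 : ℝ), ((Real.exp (-v) * Real.log v : ℝ) : ℂ) =
      -(Real.eulerMascheroniConstant : ℂ) := by
    rw [← h3]
    refine integral_congr_ae (Eventually.of_forall fun v => ?_)
    simp only [sub_self, Complex.cpow_zero, one_mul]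
    push_cast
    ring
  rw [integral_complex_ofReal] at h4
  exact_mod_cast h4

lemma integrableOn_exp_neg_mul_log :
    IntegrableOn (fun v : ℝ => Real.exp (-v) * Real.log v) (Ioi 0) := by
  -- A non-integrable function has integral 0 by convention, whereas this integral is -γ ≠ 0.
  by_contra h
  have h1 := integral_exp_neg_mul_log
  rw [integral_undef h] at h1
  linarith [Real.one_half_lt_eulerMascheroniConstant]

lemma aestronglyMeasurable_exp_neg_mul_arsinhErr {x : ℝ} (hx : 0 < x) :
    AEStronglyMeasurable (fun v : ℝ => ((Real.exp (-v) : ℝ) : ℂ) * arsinhErr (√(v / (2 * x))))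
      (volume.restrict (Ioi 0)) := by
  refine ContinuousOn.aestronglyMeasurable ?_ measurableSet_Ioi
  refine ContinuousOn.mul (by fun_prop) ?_
  have hc : ContinuousOn arsinhErr (Ioi 0) := by
    have : ContinuousOn (fun z => arsinhLog z - ((Real.log 2 + Real.log z : ℝ) : ℂ)) (Ioi 0) := by
      refine (continuousOn_arsinhLog.mono Ioi_subset_Ici_self).sub
        (Complex.continuous_ofReal.comp_continuousOn (continuousOn_const.add ?_))
      exact Real.continuousOn_log.mono fun z hz => ne_of_gt hz
    exact this.congr fun z hz => by simp only [arsinhLog_eq hz]; ring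
  refine hc.comp (by fun_prop) fun v hv => ?_
  have hv : 0 < v := hv
  exact Real.sqrt_pos.2 (by positivity)

/-- For x < 1/2 one has v ≤ v/(2x), which makes the bound uniform in x, as dominated convergence
requires. -/
lemma norm_exp_neg_mul_arsinhErr_le {x : ℝ} (hx0 : 0 < x) (hx1 : x < 1 / 2) {v : ℝ} (hv : 0 < v) :
    ‖((Real.exp (-v) : ℝ) : ℂ) * arsinhErr (√(v / (2 * x)))‖ ≤
      5 * Real.exp (-v) + Real.exp (-v) * v ^ ((1 / 2 : ℝ) - 1) := by
  rw [norm_mul, Complex.norm_real, Real.norm_of_nonneg (Real.exp_nonneg _)]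
  have hs : √v ≤ √(v / (2 * x)) := by
    refine Real.sqrt_le_sqrt ?_
    rw [le_div_iff₀ (by positivity)]
    nlinarith
  have hsv := Real.sqrt_pos.2 hv
  have e : v ^ ((1 / 2 : ℝ) - 1) = 1 / √v := by
    rw [show (1 / 2 : ℝ) - 1 = -(1 / 2) by norm_num, Real.rpow_neg hv.le, ← Real.sqrt_eq_rpow,
      one_div]
  rw [e]
  calc _ ≤ Real.exp (-v) * (5 + 1 / √v) := by
        refine mul_le_mul_of_nonneg_left ?_ (Real.exp_nonneg _)
        refine (norm_arsinhErr_le (hsv.trans_le hs)).trans ?_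
        gcongr
    _ = _ := by ring

lemma integrableOn_exp_neg_mul_rpow :
    IntegrableOn (fun v : ℝ => 5 * Real.exp (-v) + Real.exp (-v) * v ^ ((1 / 2 : ℝ) - 1)) (Ioi 0) :=
  (integrableOn_exp_neg.const_mul 5).add
    (Real.GammaIntegral_convergent (by norm_num : (0 : ℝ) < 1 / 2))

lemma eventually_pos_lt_half : ∀ᶠ x : ℝ in 𝓝[>] 0, 0 < x ∧ x < 1 / 2 := by
  filter_upwards [self_mem_nhdsWithin,
    mem_nhdsWithin_of_mem_nhds (gt_mem_nhds (by norm_num : (0 : ℝ) < 1 / 2))] with x h1 h2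
  exact ⟨h1, h2⟩

lemma tendsto_integral_arsinhErr :
    Tendsto (fun x : ℝ => ∫ v in Ioi (0 : ℝ), ((Real.exp (-v) : ℝ) : ℂ) *
      arsinhErr (√(v / (2 * x)))) (𝓝[>] 0) (𝓝 0) := by
  have h := tendsto_integral_filter_of_dominated_convergence
    (μ := volume.restrict (Ioi (0 : ℝ))) (l := 𝓝[>] (0 : ℝ))
    (F := fun x v => ((Real.exp (-v) : ℝ) : ℂ) * arsinhErr (√(v / (2 * x))))
    (f := fun _ => 0) (fun v => 5 * Real.exp (-v) + Real.exp (-v) * v ^ ((1 / 2 : ℝ) - 1))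
    (eventually_pos_lt_half.mono fun x hx => aestronglyMeasurable_exp_neg_mul_arsinhErr hx.1)
    (eventually_pos_lt_half.mono fun x hx => (ae_restrict_iff' measurableSet_Ioi).2
      (Eventually.of_forall fun v hv => norm_exp_neg_mul_arsinhErr_le hx.1 hx.2 hv))
    integrableOn_exp_neg_mul_rpow
    ((ae_restrict_iff' measurableSet_Ioi).2 (Eventually.of_forall fun v hv => by
      have hv : 0 < v := hv
      have h1 : Tendsto (fun x : ℝ => √(v / (2 * x))) (𝓝[>] 0) atTop := by
        refine Real.tendsto_sqrt_atTop.comp ?_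
        have := tendsto_inv_nhdsGT_zero (𝕜 := ℝ)
        refine (this.const_mul_atTop (by positivity : 0 < v / 2)).congr fun x => ?_
        field_simp
      simpa using (tendsto_arsinhErr.comp h1).const_mul ((Real.exp (-v) : ℝ) : ℂ)))
  simpa using h

lemma integral_exp_neg_Ioi_ofReal :
    ∫ v in Ioi (0 : ℝ), ((Real.exp (-v) : ℝ) : ℂ) = 1 := by
  rw [integral_complex_ofReal, integral_exp_neg_Ioi_zero, Complex.ofReal_one]

/-- Insert `arsinhLog z` = log(2z) + error at z = √(v/(2x)): the term (log v)/2 integrates to -γ/2,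
and iπ/4 comes from -`arsinhLog 0`. -/
lemma cisQuarter_mul_momentA_zero_eq {x : ℝ} (hx : 0 < x) (hx1 : x < 1 / 2) :
    cisQuarter * momentA 0 x =
      ((Real.log 2 - (Real.log (2 * x) + Real.eulerMascheroniConstant) / 2 : ℝ) : ℂ)
        + ((π / 4 : ℝ) : ℂ) * Complex.I
        + ∫ v in Ioi (0 : ℝ), ((Real.exp (-v) : ℝ) : ℂ) * arsinhErr (√(v / (2 * x))) := by
  rw [cisQuarter_mul_momentA_zero hx, integral_gauss_substitution hx]
  set c : ℂ := ((Real.log 2 - Real.log (2 * x) / 2 : ℝ) : ℂ) + ((π / 4 : ℝ) : ℂ) * Complex.I with hc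
  have e : ∀ v ∈ Ioi (0 : ℝ), ((Real.exp (-v) : ℝ) : ℂ) *
      (arsinhLog (√(v / (2 * x))) - arsinhLog 0) =
      (((Real.exp (-v) : ℝ) : ℂ) * c + 1 / 2 * ((Real.exp (-v) * Real.log v : ℝ) : ℂ))
        + ((Real.exp (-v) : ℝ) : ℂ) * arsinhErr (√(v / (2 * x))) := by
    intro v hv
    have hv : 0 < v := hv
    rw [arsinhLog_eq (Real.sqrt_pos.2 (by positivity)), arsinhLog_zero,
      Real.log_sqrt (by positivity), Real.log_div hv.ne' (by positivity), hc]
    push_cast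
    ring
  have i1 : IntegrableOn (fun v : ℝ => ((Real.exp (-v) : ℝ) : ℂ) * c) (Ioi 0) :=
    (integrableOn_exp_neg.ofReal (𝕜 := ℂ)).mul_const c
  have i2 : IntegrableOn (fun v : ℝ => 1 / 2 * ((Real.exp (-v) * Real.log v : ℝ) : ℂ)) (Ioi 0) :=
    (integrableOn_exp_neg_mul_log.ofReal (𝕜 := ℂ)).const_mul _
  have hi : IntegrableOn (fun v : ℝ => ((Real.exp (-v) : ℝ) : ℂ) * arsinhErr (√(v / (2 * x))))
      (Ioi 0) := integrableOn_exp_neg_mul_rpow.mono' (aestronglyMeasurable_exp_neg_mul_arsinhErr hx)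
    ((ae_restrict_iff' measurableSet_Ioi).2 (Eventually.of_forall fun v hv =>
      norm_exp_neg_mul_arsinhErr_le hx hx1 hv))
  rw [setIntegral_congr_fun measurableSet_Ioi e, integral_add (by exact i1.add i2) hi,
    integral_add i1 i2,
    integral_mul_const, integral_const_mul, integral_exp_neg_Ioi_ofReal, integral_complex_ofReal,
    integral_exp_neg_mul_log, hc]
  push_cast
  ring

lemma tendsto_exp_sub_one_mul_log (a b : ℂ) :
    Tendsto (fun x : ℝ => (Complex.exp (Complex.I * x) - 1) * (a + b * Real.log (x / 2)))
      (𝓝[>] 0) (𝓝 0) := by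
  have h1 : Tendsto (fun x : ℝ => ‖a‖ * x + ‖b‖ * |x * Real.log (x / 2)|) (𝓝[>] 0) (𝓝 0) := by
    have := (tendsto_id_zero_right.const_mul ‖a‖).add (tendsto_mul_log_half.abs.const_mul ‖b‖)
    simpa using this
  refine squeeze_zero_norm' ?_ h1
  filter_upwards [self_mem_nhdsWithin] with x hx
  have hx : 0 < x := hx
  have h2 : ‖Complex.exp (Complex.I * x) - 1‖ ≤ x := by
    simpa [abs_of_pos hx] using Real.norm_exp_I_mul_ofReal_sub_one_le (x := x)
  rw [norm_mul]
  calc _ ≤ x * (‖a‖ + ‖b * Real.log (x / 2)‖) := by gcongr; exact norm_add_le _ _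
    _ = _ := by
      rw [norm_mul, Complex.norm_real, Real.norm_eq_abs, abs_mul, abs_of_pos hx]
      ring

/-- Multiplying the expansion of the moment by -4i/π turns iπ/4 into 1 and the logarithm into
(2i/π)(log(x/2) + γ); the factor e^{ix} may be replaced by 1 because x log x → 0. -/
lemma tendsto_hankelInt0_sub_log :
    Tendsto (fun x : ℝ => hankelInt0 x - (1 + Complex.I *
      ((2 / π * (Real.log (x / 2) + Real.eulerMascheroniConstant) : ℝ) : ℂ))) (𝓝[>] 0) (𝓝 0) := by
  have h1 := tendsto_exp_sub_one_mul_log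
    (1 + Complex.I * (2 / π * Real.eulerMascheroniConstant)) (Complex.I * (2 / π))
  have h2 : Tendsto (fun x : ℝ => 4 / π * Complex.exp (Complex.I * x) * (-Complex.I) *
      ∫ v in Ioi (0 : ℝ), ((Real.exp (-v) : ℝ) : ℂ) * arsinhErr (√(v / (2 * x))))
      (𝓝[>] 0) (𝓝 0) := by
    have hc : Tendsto (fun x : ℝ => 4 / π * Complex.exp (Complex.I * x) * (-Complex.I))
        (𝓝[>] 0) (𝓝 (4 / π * Complex.exp (Complex.I * (0 : ℝ)) * (-Complex.I))) :=
      ((by fun_prop : Continuous fun x : ℝ => 4 / π * Complex.exp (Complex.I * x) *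
        (-Complex.I)).tendsto 0).mono_left nhdsWithin_le_nhds
    simpa using hc.mul tendsto_integral_arsinhErr
  have h := h1.add h2
  rw [add_zero] at h
  refine h.congr' ?_
  filter_upwards [eventually_pos_lt_half] with x hx
  obtain ⟨hx0, hx1⟩ := hx
  have e := cisQuarter_mul_momentA_zero_eq hx0 hx1
  set E := ∫ v in Ioi (0 : ℝ), ((Real.exp (-v) : ℝ) : ℂ) * arsinhErr (√(v / (2 * x)))
  have e1 : hankelInt0 x = 4 / π * Complex.exp (Complex.I * x) * (-Complex.I) *
      (cisQuarter * momentA 0 x) := by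
    have e2 : Complex.exp (Complex.I * ((x - π / 4 : ℝ) : ℂ)) * cisQuarter =
        Complex.exp (Complex.I * x) := by
      rw [cisQuarter, ← Complex.exp_add]
      congr 1
      push_cast
      ring
    rw [hankelInt0, hankelPhase, ← e2]
    have h3 := cisQuarter_sq
    linear_combination (4 / π * Complex.exp (Complex.I * ((x - π / 4 : ℝ) : ℂ)) * momentA 0 x) *
      (Complex.I * h3 + Complex.I_sq)
  rw [e1, e, Real.log_div hx0.ne' two_ne_zero, Real.log_mul two_ne_zero hx0.ne']
  have hpi := Complex.ofReal_ne_zero.2 pi_ne_zero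
  push_cast
  field_simp
  linear_combination (2 * π * Complex.exp (Complex.I * x)) * Complex.I_sq

/-! ### Identification of the Hankel functions with the integrals -/

/-- The first-order form `f₀' = -f₁`, `(x f₁)' = x f₀` of Bessel's equation of order zero on the
positive half-line. -/
def IsBesselPair (f₀ f₁ : ℝ → ℂ) : Prop :=
  ∀ x : ℝ, 0 < x → HasDerivAt f₀ (-f₁ x) x ∧
    HasDerivAt (fun x : ℝ => (x : ℂ) * f₁ x) (x * f₀ x) x

lemma IsBesselPair.sub {f₀ f₁ g₀ g₁ : ℝ → ℂ} (hf : IsBesselPair f₀ f₁) (hg : IsBesselPair g₀ g₁) :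
    IsBesselPair (fun x => f₀ x - g₀ x) (fun x => f₁ x - g₁ x) := fun x hx => by
  refine ⟨((hf x hx).1.sub (hg x hx).1).congr_deriv (by ring), ?_⟩
  refine (((hf x hx).2.sub (hg x hx).2).congr_deriv (by ring)).congr_of_eventuallyEq ?_
  exact Eventually.of_forall fun y => by simp [mul_sub]

/-- The factor x in the system makes x times the Wronskian have zero derivative. -/
lemma IsBesselPair.exists_wronskian {f₀ f₁ g₀ g₁ : ℝ → ℂ} (hf : IsBesselPair f₀ f₁)
    (hg : IsBesselPair g₀ g₁) :
    ∃ c : ℂ, ∀ x : ℝ, 0 < x → f₀ x * (x * g₁ x) - x * f₁ x * g₀ x = c := by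
  have hd : ∀ x ∈ Ioi (0 : ℝ), HasDerivAt (fun x : ℝ => f₀ x * (x * g₁ x) - x * f₁ x * g₀ x) 0 x :=
    fun x hx => by
      refine (((hf x hx).1.mul (hg x hx).2).sub ((hf x hx).2.mul (hg x hx).1)).congr_deriv ?_
      ring
  refine ⟨f₀ 1 * ((1 : ℝ) * g₁ 1) - (1 : ℝ) * f₁ 1 * g₀ 1, fun x hx => ?_⟩
  exact isOpen_Ioi.is_const_of_deriv_eq_zero isPreconnected_Ioi
    (fun y hy => (hd y hy).differentiableAt.differentiableWithinAt)
    (fun y hy => (hd y hy).deriv) hx (mem_Ioi.2 one_pos)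

lemma isBesselPair_besselJ :
    IsBesselPair (fun x => (besselJ 0 x : ℂ)) (fun x => (besselJ 1 x : ℂ)) := fun x _ => by
  have h1 := (hasDerivAt_besselJ_zero x).ofReal_comp
  have h2 := (hasDerivAt_mul_besselJ_one x).ofReal_comp
  push_cast at h1 h2
  exact ⟨h1, h2⟩

lemma isBesselPair_besselY :
    IsBesselPair (fun x => (besselY 0 x : ℂ)) (fun x => (besselY 1 x : ℂ)) := fun x hx => by
  have h1 := (hasDerivAt_besselY_zero hx).ofReal_comp
  have h2 := (hasDerivAt_mul_besselY_one hx).ofReal_comp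
  push_cast at h1 h2
  exact ⟨h1, h2⟩

lemma isBesselPair_hankel1 : IsBesselPair (hankel1 0) (hankel1 1) := fun x hx => by
  obtain ⟨h1, h2⟩ := isBesselPair_besselJ x hx
  obtain ⟨h3, h4⟩ := isBesselPair_besselY x hx
  refine ⟨(h1.add (h3.const_mul Complex.I)).congr_deriv (by simp only [hankel1]; ring), ?_⟩
  refine ((h2.add (h4.const_mul Complex.I)).congr_deriv
    (by simp only [hankel1]; ring)).congr_of_eventuallyEq ?_
  exact Eventually.of_forall fun y => by simp only [hankel1, Pi.add_apply]; ring

lemma isBesselPair_hankelInt : IsBesselPair hankelInt0 hankelInt1 := fun _ hx =>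
  ⟨hasDerivAt_hankelInt0 hx, hasDerivAt_mul_hankelInt1 hx⟩

/-- The constant is read off at the origin, where J_0 → 1 and x Y_1 → -2/π. -/
lemma wronskian_besselJ_besselY {x : ℝ} (hx : 0 < x) :
    besselJ 1 x * besselY 0 x - besselJ 0 x * besselY 1 x = 2 / (π * x) := by
  obtain ⟨c, hc⟩ := isBesselPair_besselJ.exists_wronskian isBesselPair_besselY
  have h1 : Tendsto (fun x => besselJ 0 x * (x * besselY 1 x) - besselJ 1 x * (x * besselY 0 x))
      (𝓝[>] 0) (𝓝 (1 * (-(2 / π)) - 0 * 0)) :=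
    (tendsto_besselJ_zero.mul tendsto_mul_besselY_one).sub
      (tendsto_besselJ_one.mul tendsto_mul_besselY_zero)
  have h2 : Tendsto (fun x => ((besselJ 0 x * (x * besselY 1 x)
      - besselJ 1 x * (x * besselY 0 x) : ℝ) : ℂ)) (𝓝[>] 0) (𝓝 c) := by
    refine tendsto_const_nhds.congr' ?_
    filter_upwards [self_mem_nhdsWithin] with y hy
    rw [← hc y hy]
    push_cast
    ring
  have h3 := tendsto_nhds_unique ((Complex.continuous_ofReal.tendsto _).comp h1) h2
  have h4 := hc x hx
  rw [← h3] at h4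
  have h5 : besselJ 0 x * (x * besselY 1 x) - x * besselJ 1 x * besselY 0 x =
      1 * (-(2 / π)) - 0 * 0 := by exact_mod_cast h4
  field_simp
  field_simp at h5
  linarith

lemma tendsto_log_half_atBot : Tendsto (fun x : ℝ => Real.log (x / 2)) (𝓝[>] 0) atBot := by
  have h := tendsto_atBot_add_const_right (𝓝[>] (0 : ℝ)) (-Real.log 2) Real.tendsto_log_nhdsGT_zero
  refine h.congr' ?_
  filter_upwards [self_mem_nhdsWithin] with x hx
  rw [Real.log_div (ne_of_gt hx) two_ne_zero]
  ring

lemma tendsto_inv_log_half : Tendsto (fun x : ℝ => (Real.log (x / 2))⁻¹) (𝓝[>] 0) (𝓝 0) :=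
  tendsto_inv_atBot_zero.comp tendsto_log_half_atBot

lemma tendsto_besselY_zero_div_log :
    Tendsto (fun x => besselY 0 x * (Real.log (x / 2))⁻¹) (𝓝[>] 0) (𝓝 (2 / π)) := by
  have h := ((tendsto_besselY_zero_sub_log.add_const
    (2 / π * Real.eulerMascheroniConstant)).mul tendsto_inv_log_half).add_const (2 / π)
  simp only [mul_zero, zero_add] at h
  refine h.congr' ?_
  filter_upwards [tendsto_log_half_atBot.eventually_lt_atBot 0] with x hx
  have := hx.ne
  field_simp
  ring

lemma tendsto_hankelInt0_sub_hankel1 :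
    Tendsto (fun x => hankelInt0 x - hankel1 0 x) (𝓝[>] 0) (𝓝 0) := by
  have h1 := (Complex.continuous_ofReal.tendsto _).comp (tendsto_besselJ_zero.sub_const 1)
  have h2 := ((Complex.continuous_ofReal.tendsto _).comp
    tendsto_besselY_zero_sub_log).const_mul Complex.I
  have h := (tendsto_hankelInt0_sub_log.sub h1).sub h2
  simp only [sub_self, Complex.ofReal_zero, mul_zero] at h
  refine h.congr fun x => ?_
  simp only [hankel1, Function.comp_apply]
  push_cast
  ring

/-- The Wronskians with J and Y are two linear equations that determine f₀ as a combination of Y_0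
and J_0. Dividing by log(x/2) at the origin kills the coefficient of Y_0, and then the limit of f₀
kills that of J_0. -/
lemma IsBesselPair.eq_zero_of_tendsto {f₀ f₁ : ℝ → ℂ} (hf : IsBesselPair f₀ f₁)
    (h0 : Tendsto f₀ (𝓝[>] 0) (𝓝 0)) {x : ℝ} (hx : 0 < x) : f₀ x = 0 := by
  obtain ⟨a, ha⟩ := hf.exists_wronskian isBesselPair_besselJ
  obtain ⟨b, hb⟩ := hf.exists_wronskian isBesselPair_besselY
  have key : ∀ x : ℝ, 0 < x → f₀ x = π / 2 * (a * besselY 0 x - b * besselJ 0 x) := by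
    intro x hx
    have hw := wronskian_besselJ_besselY hx
    have hw' : (besselJ 1 x : ℂ) * besselY 0 x - besselJ 0 x * besselY 1 x = 2 / (π * x) := by
      exact_mod_cast hw
    have hpi := Complex.ofReal_ne_zero.2 pi_ne_zero
    have hx' := Complex.ofReal_ne_zero.2 hx.ne'
    rw [← ha x hx, ← hb x hx]
    have e : f₀ x = π / 2 * (x * f₀ x * (2 / (π * x))) := by field_simp
    linear_combination e - π / 2 * (x * f₀ x) * hw'
  have hY := (Complex.continuous_ofReal.tendsto _).comp tendsto_besselY_zero_div_log
  have hJ := (Complex.continuous_ofReal.tendsto _).comp tendsto_besselJ_zero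
  have hI := (Complex.continuous_ofReal.tendsto _).comp tendsto_inv_log_half
  have ha0 : a = 0 := by
    have h1 : Tendsto (fun x => f₀ x * (((Real.log (x / 2))⁻¹ : ℝ) : ℂ)) (𝓝[>] 0)
        (𝓝 (π / 2 * (a * (2 / π : ℝ) - b * ((1 : ℝ) * (0 : ℝ))))) := by
      refine (((hY.const_mul a).sub ((hJ.mul hI).const_mul b)).const_mul (π / 2 : ℂ)).congr' ?_
      filter_upwards [self_mem_nhdsWithin] with y hy
      rw [key y hy]
      simp only [Function.comp_apply]
      push_cast
      ring
    have h2 := tendsto_nhds_unique h1 (h0.mul hI)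
    have hpi := Complex.ofReal_ne_zero.2 pi_ne_zero
    push_cast at h2
    field_simp at h2
    simpa using h2
  have hb0 : b = 0 := by
    have h1 : Tendsto f₀ (𝓝[>] 0) (𝓝 (π / 2 * (-b * (1 : ℝ)))) := by
      refine ((hJ.const_mul (-b)).const_mul (π / 2 : ℂ)).congr' ?_
      filter_upwards [self_mem_nhdsWithin] with y hy
      rw [key y hy, ha0]
      simp only [Function.comp_apply]
      ring
    have h2 := tendsto_nhds_unique h1 h0
    have hpi := Complex.ofReal_ne_zero.2 pi_ne_zero
    simpa [hpi] using h2
  rw [key x hx, ha0, hb0]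
  ring

lemma hankel1_zero_eq {x : ℝ} (hx : 0 < x) : hankel1 0 x = hankelInt0 x :=
  (sub_eq_zero.1 ((isBesselPair_hankelInt.sub isBesselPair_hankel1).eq_zero_of_tendsto
    tendsto_hankelInt0_sub_hankel1 hx)).symm

lemma hankel1_one_eq {x : ℝ} (hx : 0 < x) : hankel1 1 x = hankelInt1 x := by
  have h1 : hankel1 0 =ᶠ[𝓝 x] hankelInt0 := by
    filter_upwards [lt_mem_nhds hx] with y hy using hankel1_zero_eq hy
  have h2 := (isBesselPair_hankel1 x hx).1.unique
    ((hasDerivAt_hankelInt0 hx).congr_of_eventuallyEq h1)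
  exact neg_injective h2

/-- The leading term of `H_n^{(1)}(x) = √(2 / (π x)) (e^{i (x - n π / 2 - π / 4)} + O(1 / x))`. -/
def hankelLead (n : ℕ) (x : ℝ) : ℂ := Complex.exp (Complex.I * ((x - n * (π / 2) - π / 4 : ℝ) : ℂ))

lemma norm_hankelLead (n : ℕ) (x : ℝ) : ‖hankelLead n x‖ = 1 := by
  rw [hankelLead, mul_comm, Complex.norm_exp_ofReal_mul_I]

/-- `√(2 / (π x))`. -/
def besselAmp (x : ℝ) : ℝ := √(2 / (π * x))

lemma besselAmp_nonneg (x : ℝ) : 0 ≤ besselAmp x := Real.sqrt_nonneg _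

theorem exists_hankel1_bound {n : ℕ} (hn : n ≤ 1) : ∃ C : ℝ, 0 ≤ C ∧ ∀ x : ℝ, 0 < x →
    ‖hankel1 n x - besselAmp x * hankelLead n x‖ ≤ C * (besselAmp x / x) := by
  interval_cases n
  · obtain ⟨C, hC, h⟩ := exists_hankelInt0_bound
    refine ⟨C, hC, fun x hx => ?_⟩
    have := h x hx
    rw [hankel1_zero_eq hx]
    simpa [hankelLead, besselAmp] using this
  · obtain ⟨C, hC, h⟩ := exists_hankelInt1_bound
    refine ⟨C, hC, fun x hx => ?_⟩
    have := h x hx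
    rw [hankel1_one_eq hx]
    simpa [hankelLead, besselAmp] using this

/-- J_n is the real part of H_n^{(1)}, and taking real parts does not increase the error. -/
theorem exists_besselJ_bound {n : ℕ} (hn : n ≤ 1) : ∃ C : ℝ, 0 ≤ C ∧ ∀ x : ℝ, 0 < x →
    |besselJ n x - besselAmp x * (hankelLead n x).re| ≤ C * (besselAmp x / x) := by
  obtain ⟨C, hC, h⟩ := exists_hankel1_bound hn
  refine ⟨C, hC, fun x hx => (le_trans ?_ (Complex.abs_re_le_norm _)).trans (h x hx)⟩
  simp [hankel1]

/-! ### Products of Bessel and Hankel functions -/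

lemma tendsto_mul_const_zero_right {p : ℝ} (hp : 0 < p) :
    Tendsto (fun ω : ℝ => ω * p) (𝓝[>] 0) (𝓝[>] 0) := by
  refine tendsto_nhdsWithin_iff.2 ⟨?_, ?_⟩
  · simpa using tendsto_id_zero_right.mul_const p
  · filter_upwards [self_mem_nhdsWithin] with x hx
    exact mul_pos hx hp

lemma exists_tendsto_besselJ {n : ℕ} (hn : n ≤ 1) :
    ∃ l : ℝ, Tendsto (besselJ n) (𝓝[>] 0) (𝓝 l) := by
  interval_cases n
  exacts [⟨_, tendsto_besselJ_zero⟩, ⟨_, tendsto_besselJ_one⟩]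

lemma exists_tendsto_mul_hankel1 {n : ℕ} (hn : n ≤ 1) :
    ∃ l : ℂ, Tendsto (fun x : ℝ => (x : ℂ) * hankel1 n x) (𝓝[>] 0) (𝓝 l) := by
  obtain ⟨a, ha⟩ := exists_tendsto_besselJ hn
  have hY : ∃ b : ℝ, Tendsto (fun x => x * besselY n x) (𝓝[>] 0) (𝓝 b) := by
    interval_cases n
    exacts [⟨_, tendsto_mul_besselY_zero⟩, ⟨_, tendsto_mul_besselY_one⟩]
  obtain ⟨b, hb⟩ := hY
  refine ⟨_, (((Complex.continuous_ofReal.tendsto _).comp (tendsto_id_zero_right.mul ha)).add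
    (((Complex.continuous_ofReal.tendsto _).comp hb).const_mul Complex.I)).congr fun x => ?_⟩
  simp only [hankel1, Function.comp_apply]
  push_cast
  ring

lemma continuous_besselJ (n : ℕ) : Continuous (besselJ n) := by
  have h : Continuous (seriesJ n) :=
    continuous_iff_continuousAt.2 fun t => (hasDerivAt_entire (abs_coeffJ_le n) t).continuousAt
  have e : besselJ n = fun x => (x / 2) ^ n * seriesJ n (x ^ 2 / 4) := funext (besselJ_eq n)
  rw [e]
  fun_prop

lemma continuousOn_hankel1 {n : ℕ} (hn : n ≤ 1) : ContinuousOn (hankel1 n) (Ioi 0) := by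
  intro x hx
  have hx : 0 < x := hx
  refine ContinuousAt.continuousWithinAt ?_
  interval_cases n
  · exact (isBesselPair_hankel1 x hx).1.continuousAt
  · have h := (isBesselPair_hankel1 x hx).2.continuousAt
    have hx' := Complex.ofReal_ne_zero.2 hx.ne'
    have h2 := h.div (Complex.continuous_ofReal.continuousAt (x := x)) hx'
    refine h2.congr ?_
    filter_upwards [lt_mem_nhds hx] with y hy
    have hy' := Complex.ofReal_ne_zero.2 hy.ne'
    simp only [Pi.div_apply]
    field_simp

/-- `ω J_m(ω p) H_n^{(1)}(ω q)`. -/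
def besselProd (m n : ℕ) (p q ω : ℝ) : ℂ := ω * besselJ m (ω * p) * hankel1 n (ω * q)

lemma continuousOn_besselProd (m : ℕ) {n : ℕ} (hn : n ≤ 1) (p : ℝ) {q : ℝ} (hq : 0 < q) :
    ContinuousOn (besselProd m n p q) (Ioi 0) := by
  have h1 := continuous_besselJ m
  refine ContinuousOn.mul (by fun_prop) ((continuousOn_hankel1 hn).comp (by fun_prop) ?_)
  exact fun ω hω => mul_pos hω hq

/-- The factor ω is spent on the Hankel function, whose singularity at 0 is at worst 1/x. -/
lemma exists_tendsto_besselProd {m n : ℕ} (hm : m ≤ 1) (hn : n ≤ 1) {p q : ℝ} (hp : 0 < p)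
    (hq : 0 < q) : ∃ l : ℂ, Tendsto (besselProd m n p q) (𝓝[>] 0) (𝓝 l) := by
  obtain ⟨a, ha⟩ := exists_tendsto_besselJ hm
  obtain ⟨b, hb⟩ := exists_tendsto_mul_hankel1 hn
  have h1 := (Complex.continuous_ofReal.tendsto _).comp (ha.comp (tendsto_mul_const_zero_right hp))
  have h2 := hb.comp (tendsto_mul_const_zero_right hq)
  refine ⟨_, ((h1.mul h2).mul_const (q : ℂ)⁻¹).congr fun ω => ?_⟩
  have := Complex.ofReal_ne_zero.2 hq.ne'
  simp only [besselProd, Function.comp_apply]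
  push_cast
  field_simp

lemma mul_besselAmp_mul_besselAmp {p q ω : ℝ} (hp : 0 < p) (hω : 0 < ω) :
    ω * (besselAmp (ω * p) * besselAmp (ω * q)) = 2 / (π * √(p * q)) := by
  rw [besselAmp, besselAmp, ← Real.sqrt_mul (by positivity),
    show 2 / (π * (ω * p)) * (2 / (π * (ω * q))) = (2 / (π * ω)) ^ 2 * (p * q)⁻¹ by
      field_simp,
    Real.sqrt_mul (by positivity), Real.sqrt_sq (by positivity), Real.sqrt_inv]
  field_simp

theorem exists_besselProd_bound {m n : ℕ} (hm : m ≤ 1) (hn : n ≤ 1) {p q : ℝ} (hp : 0 < p)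
    (hq : 0 < q) : ∃ C : ℝ, ∀ ω : ℝ, 1 ≤ ω →
    ‖besselProd m n p q ω - (2 / (π * √(p * q)) : ℝ) *
      ((hankelLead m (ω * p)).re * hankelLead n (ω * q))‖ ≤ C / ω := by
  obtain ⟨C₁, hC₁, h₁⟩ := exists_besselJ_bound hm
  obtain ⟨C₂, hC₂, h₂⟩ := exists_hankel1_bound hn
  refine ⟨2 / (π * √(p * q)) * (C₁ / p * (1 + C₂ / q) + C₂ / q), fun ω hω => ?_⟩
  have hω0 : 0 < ω := by linarith
  have k₁ := h₁ (ω * p) (by positivity)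
  have k₂ := h₂ (ω * q) (by positivity)
  have key := mul_besselAmp_mul_besselAmp (q := q) hp hω0
  have a0 := besselAmp_nonneg (ω * p)
  have b0 := besselAmp_nonneg (ω * q)
  set a := besselAmp (ω * p)
  set b := besselAmp (ω * q)
  set J := besselJ m (ω * p) with hJ
  set H := hankel1 n (ω * q) with hH
  set l := hankelLead n (ω * q)
  set c := (hankelLead m (ω * p)).re
  have hl : ‖l‖ = 1 := norm_hankelLead _ _
  have hc : |c| ≤ 1 := (Complex.abs_re_le_norm _).trans_eq (norm_hankelLead _ _)
  have hHn : ‖H‖ ≤ b * (1 + C₂ / q) := by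
    have e : H = (H - b * l) + b * l := by ring
    rw [e]
    refine (norm_add_le _ _).trans ?_
    rw [norm_mul, hl, Complex.norm_real, Real.norm_of_nonneg b0]
    have : C₂ * (b / (ω * q)) ≤ b * (C₂ / q) := by
      rw [show C₂ * (b / (ω * q)) = b * (C₂ / q) / ω by field_simp]
      exact div_le_self (by positivity) hω
    linarith
  -- The usual splitting JH - (ac)(bl) = (J - ac)H + ac(H - bl); each half gains 1/ω, and ω * a * b
  -- is constant.
  have e : besselProd m n p q ω - (2 / (π * √(p * q)) : ℝ) * (c * l) =
      ω * (((J - a * c : ℝ) : ℂ) * H + ((a * c : ℝ) : ℂ) * (H - b * l)) := by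
    rw [← key, besselProd, ← hJ, ← hH]
    push_cast
    ring
  rw [e, norm_mul, Complex.norm_real, Real.norm_of_nonneg hω0.le]
  have h3 : ‖((J - a * c : ℝ) : ℂ) * H + ((a * c : ℝ) : ℂ) * (H - b * l)‖ ≤
      C₁ * (a / (ω * p)) * (b * (1 + C₂ / q)) + a * 1 * (C₂ * (b / (ω * q))) := by
    refine (norm_add_le _ _).trans ?_
    rw [norm_mul, norm_mul, Complex.norm_real, Complex.norm_real, Real.norm_eq_abs,
      Real.norm_eq_abs, abs_mul, abs_of_nonneg a0]
    gcongr
  calc _ ≤ ω * (C₁ * (a / (ω * p)) * (b * (1 + C₂ / q)) + a * 1 * (C₂ * (b / (ω * q)))) := by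
        gcongr
    _ = ω * (a * b) * (C₁ / p * (1 + C₂ / q) + C₂ / q) / ω := by
        field_simp
    _ = _ := by rw [key]

lemma re_hankelLead_mul (m n : ℕ) (x y : ℝ) :
    ((hankelLead m x).re : ℂ) * hankelLead n y =
      1 / 2 * (Complex.exp (Complex.I * ((y + x - (m + n + 1) * (π / 2) : ℝ) : ℂ))
        + Complex.exp (Complex.I * ((y - x - (n - m) * (π / 2) : ℝ) : ℂ))) := by
  rw [Complex.re_eq_add_conj, hankelLead, hankelLead, ← Complex.exp_conj, map_mul, Complex.conj_I,
    Complex.conj_ofReal, add_div, add_mul, div_mul_eq_mul_div, div_mul_eq_mul_div, ← Complex.exp_add,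
    ← Complex.exp_add, mul_add]
  rw [one_div, inv_mul_eq_div, inv_mul_eq_div]
  congr 3 <;> push_cast <;> ring

/-! ### The kernels of the solenoid -/

/-- Order of the Bessel function of the first kind in the kernel. -/
def Field.orderJ (c : Field) : ℕ := match c with | .Bin => 0 | _ => 1

/-- Order of the Hankel function in the kernel. -/
def Field.orderH (c : Field) : ℕ := match c with | .Bout => 0 | _ => 1

/-- The smaller radius. -/
def Field.inner (c : Field) (R r : ℝ) : ℝ := match c with | .Ein | .Bin => r | _ => R

/-- The larger radius. -/
def Field.outer (c : Field) (R r : ℝ) : ℝ := match c with | .Ein | .Bin => R | _ => r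

/-- The constant factor of the kernel, up to `π R / 2`. -/
def Field.phase (c : Field) : ℂ := match c with | .Ein | .Eout => -1 | _ => Complex.I

lemma Field.orderJ_le (c : Field) : c.orderJ ≤ 1 := by cases c <;> simp [Field.orderJ]

lemma Field.orderH_le (c : Field) : c.orderH ≤ 1 := by cases c <;> simp [Field.orderH]

lemma Field.norm_phase (c : Field) : ‖c.phase‖ = 1 := by cases c <;> simp [Field.phase]

lemma Field.sign_eq (c : Field) : c.sign = 1 ∨ c.sign = -1 := by cases c <;> simp [Field.sign]

lemma Field.inner_pos {R r : ℝ} (hR : 0 < R) (hr : 0 < r) (c : Field) : 0 < c.inner R r := by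
  cases c <;> simpa [Field.inner]

lemma Field.outer_pos {R r : ℝ} (hR : 0 < R) (hr : 0 < r) (c : Field) : 0 < c.outer R r := by
  cases c <;> simpa [Field.outer]

lemma Field.mul_inv_sqrt {R r : ℝ} (hR : 0 < R) (hr : 0 < r) (c : Field) :
    R * (√(c.inner R r * c.outer R r))⁻¹ = √(R / r) := by
  have h : c.inner R r * c.outer R r = R * r := by
    cases c <;> simp [Field.inner, Field.outer, mul_comm]
  rw [h, Real.sqrt_mul hR.le, Real.sqrt_div hR.le]
  have h1 := Real.sqrt_pos.2 hR
  have h2 := Real.sqrt_pos.2 hr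
  field_simp
  rw [Real.sq_sqrt hR.le]

lemma Field.kernel_eq (c : Field) (R r ω : ℝ) :
    c.kernel R r ω = c.phase * (π / 2 * R : ℝ) *
      besselProd c.orderJ c.orderH (c.inner R r) (c.outer R r) ω := by
  cases c <;> simp [Field.kernel, Field.phase, Field.orderJ, Field.orderH, Field.inner, Field.outer,
    besselProd] <;> ring

lemma Field.outer_sub_inner {R r : ℝ} {c : Field} (hc : c.Region R r) :
    c.outer R r - c.inner R r = |r - R| := by
  cases c <;> simp only [Field.Region, Field.inner, Field.outer] at hc ⊢
  · rw [abs_of_nonpos (by linarith)]; ring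
  · rw [abs_of_nonneg (by linarith)]
  · rw [abs_of_nonpos (by linarith)]; ring
  · rw [abs_of_nonneg (by linarith)]

lemma Field.outer_add_inner (c : Field) (R r : ℝ) : c.outer R r + c.inner R r = R + r := by
  cases c <;> simp [Field.inner, Field.outer, add_comm]

/-- The prefactor times i^{m-n}, with m and n the orders of J and H, is the sign ±: -1 for both
electric fields (m = n), i · i^{-1} = 1 for `Bin`, i · i = -1 for `Bout`. The phase of the sum
frequency always reduces to -π/2. -/
lemma Field.kernelHF_eq {R r : ℝ} (hR : 0 < R) (hr : 0 < r) {c : Field} (hc : c.Region R r)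
    (ω : ℝ) :
    c.kernelHF R r ω = c.phase * (π / 2 * R : ℝ) *
      ((2 / (π * √(c.inner R r * c.outer R r)) : ℝ) *
        ((hankelLead c.orderJ (ω * c.inner R r)).re * hankelLead c.orderH (ω * c.outer R r))) := by
  have e : (π / 2 * R) * (2 / (π * √(c.inner R r * c.outer R r))) = √(R / r) := by
    rw [← c.mul_inv_sqrt hR hr]
    field_simp
  rw [re_hankelLead_mul, ← mul_add, ← mul_sub, Field.outer_sub_inner hc, c.outer_add_inner,
    mul_assoc c.phase, ← mul_assoc ((π / 2 * R : ℝ) : ℂ), ← Complex.ofReal_mul, e, kernelHF,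
    mul_comm ω |r - R|, mul_comm ω (R + r)]
  have hI := Complex.exp_neg_pi_div_two_mul_I
  cases c <;> simp only [phase, sign, orderJ, orderH] <;> push_cast
  · have e1 : Complex.exp (Complex.I * ((R + r) * ω - (1 + 1 + 1) * (π / 2))) =
        -Complex.exp (Complex.I * ((R + r) * ω - π / 2)) := by
      rw [← neg_one_mul, ← Complex.exp_neg_pi_mul_I, ← Complex.exp_add]
      ring_nf
    rw [e1]
    ring_nf
  · have e1 : Complex.exp (Complex.I * ((R + r) * ω - (1 + 1 + 1) * (π / 2))) =
        -Complex.exp (Complex.I * ((R + r) * ω - π / 2)) := by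
      rw [← neg_one_mul, ← Complex.exp_neg_pi_mul_I, ← Complex.exp_add]
      ring_nf
    rw [e1]
    ring_nf
  · have e1 : Complex.exp (Complex.I * ((R + r) * ω - (0 + 1 + 1) * (π / 2))) =
        -Complex.I * Complex.exp (Complex.I * ((R + r) * ω - π / 2)) := by
      rw [← hI, ← Complex.exp_add]
      ring_nf
    have e2 : Complex.exp (Complex.I * ((|r - R| : ℝ) * ω - (1 - 0) * (π / 2))) =
        -Complex.I * Complex.exp (Complex.I * ((|r - R| : ℝ) * ω)) := by
      rw [← hI, ← Complex.exp_add]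
      ring_nf
    rw [e1, e2]
    linear_combination (1 / 2 * √(R / r) * (Complex.exp (Complex.I * ((|r - R| : ℝ) * ω))
      + Complex.exp (Complex.I * ((R + r) * ω - π / 2)))) * Complex.I_sq
  · have e1 : Complex.exp (Complex.I * ((R + r) * ω - (1 + 0 + 1) * (π / 2))) =
        -Complex.I * Complex.exp (Complex.I * ((R + r) * ω - π / 2)) := by
      rw [← hI, ← Complex.exp_add]
      ring_nf
    have e2 : Complex.exp (Complex.I * ((|r - R| : ℝ) * ω - (0 - 1) * (π / 2))) =
        Complex.I * Complex.exp (Complex.I * ((|r - R| : ℝ) * ω)) := by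
      have e3 := Complex.exp_add (π / 2 * Complex.I) (Complex.I * ((|r - R| : ℝ) * ω))
      rw [Complex.exp_pi_div_two_mul_I] at e3
      rw [← e3]
      ring_nf
    rw [e1, e2]
    linear_combination (1 / 2 * √(R / r) * (-Complex.exp (Complex.I * ((|r - R| : ℝ) * ω))
      + Complex.exp (Complex.I * ((R + r) * ω - π / 2)))) * Complex.I_sq

theorem Field.exists_kernelSI_bound {R r : ℝ} (hR : 0 < R) (hr : 0 < r) {c : Field}
    (hc : c.Region R r) : ∃ C : ℝ, ∀ ω : ℝ, 1 ≤ ω → ‖c.kernelSI R r ω‖ ≤ C / ω := by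
  obtain ⟨C, hC⟩ := exists_besselProd_bound c.orderJ_le c.orderH_le (c.inner_pos hR hr)
    (c.outer_pos hR hr)
  refine ⟨π / 2 * R * C, fun ω hω => ?_⟩
  rw [kernelSI, kernel_eq, kernelHF_eq hR hr hc, ← mul_sub, norm_mul, norm_mul, c.norm_phase,
    one_mul, Complex.norm_real, Real.norm_of_nonneg (by positivity), mul_div_assoc]
  exact mul_le_mul_of_nonneg_left (hC ω hω) (by positivity)

lemma Field.continuous_kernelHF (c : Field) (R r : ℝ) : Continuous (c.kernelHF R r) := by
  unfold Field.kernelHF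
  fun_prop

lemma Field.continuousOn_kernel {R r : ℝ} (hR : 0 < R) (hr : 0 < r) (c : Field) :
    ContinuousOn (c.kernel R r) (Ioi 0) := by
  rw [funext (c.kernel_eq R r)]
  exact continuousOn_const.mul (continuousOn_besselProd _ c.orderH_le _ (c.outer_pos hR hr))

lemma Field.exists_tendsto_kernel {R r : ℝ} (hR : 0 < R) (hr : 0 < r) (c : Field) :
    ∃ l : ℂ, Tendsto (c.kernel R r) (𝓝[>] 0) (𝓝 l) := by
  obtain ⟨l, hl⟩ := exists_tendsto_besselProd c.orderJ_le c.orderH_le (c.inner_pos hR hr)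
    (c.outer_pos hR hr)
  rw [funext (c.kernel_eq R r)]
  exact ⟨_, hl.const_mul _⟩

/-! ### Square-integrability of the remainder -/

lemma exists_bound_of_continuousOn_Ioi {f : ℝ → ℂ} (hf : ContinuousOn f (Ioi 0))
    (h0 : ∃ l, Tendsto f (𝓝[>] 0) (𝓝 l)) (b : ℝ) : ∃ M, ∀ x ∈ Ioc 0 b, ‖f x‖ ≤ M := by
  -- Give f its limit as value at 0 and use compactness of [0, b].
  obtain ⟨l, hl⟩ := h0
  have h : ContinuousOn (Function.update f 0 l) (Icc 0 b) := by
    rw [continuousOn_update_iff]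
    refine ⟨hf.mono fun x hx => lt_of_le_of_ne hx.1.1 (Ne.symm hx.2), fun _ => ?_⟩
    exact hl.mono_left (nhdsWithin_mono _ fun x hx => lt_of_le_of_ne hx.1.1 (Ne.symm hx.2))
  obtain ⟨M, hM⟩ := isCompact_Icc.exists_bound_of_continuousOn h
  refine ⟨M, fun x hx => ?_⟩
  have := hM x (Ioc_subset_Icc_self hx)
  rwa [Function.update_of_ne hx.1.ne'] at this

lemma memLp_two_of_bound {f : ℝ → ℂ} (hf : ContinuousOn f (Ioi 0))
    (h0 : ∃ l, Tendsto f (𝓝[>] 0) (𝓝 l)) {C : ℝ} (hC : ∀ x, 1 ≤ x → ‖f x‖ ≤ C / x) :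
    MemLp f 2 (volume.restrict (Ioi 0)) := by
  obtain ⟨M, hM⟩ := exists_bound_of_continuousOn_Ioi hf h0 1
  have hm := hf.aestronglyMeasurable (μ := volume) measurableSet_Ioi
  rw [memLp_two_iff_integrable_sq_norm hm]
  refine ((integrable_inv_one_add_sq.const_mul (2 * M ^ 2 + 2 * C ^ 2)).integrableOn).mono'
    (hm.norm.pow 2) ((ae_restrict_iff' measurableSet_Ioi).2 (Eventually.of_forall fun x hx => ?_))
  have hx : 0 < x := hx
  rw [Real.norm_of_nonneg (by positivity), ← div_eq_mul_inv, le_div_iff₀ (by positivity)]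
  rcases le_total x 1 with h1 | h1
  · have h2 := hM x ⟨hx, h1⟩
    have h3 : ‖f x‖ ^ 2 ≤ M ^ 2 := pow_le_pow_left₀ (norm_nonneg _) h2 2
    have h4 : 1 + x ^ 2 ≤ 2 := by nlinarith
    nlinarith [sq_nonneg C, sq_nonneg ‖f x‖]
  · have h2 := hC x h1
    rw [le_div_iff₀ hx] at h2
    have h3 : (‖f x‖ * x) ^ 2 ≤ C ^ 2 := pow_le_pow_left₀ (by positivity) h2 2
    have h4 : 1 + x ^ 2 ≤ 2 * x ^ 2 := by nlinarith
    nlinarith [sq_nonneg M, sq_nonneg ‖f x‖]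

theorem Field.memLp_kernelSI {R r : ℝ} (hR : 0 < R) (hr : 0 < r) {c : Field}
    (hc : c.Region R r) : MemLp (c.kernelSI R r) 2 (volume.restrict (Ioi 0)) := by
  obtain ⟨C, hC⟩ := Field.exists_kernelSI_bound hR hr hc
  obtain ⟨l, hl⟩ := c.exists_tendsto_kernel hR hr
  refine memLp_two_of_bound ((c.continuousOn_kernel hR hr).sub
    (c.continuous_kernelHF R r).continuousOn) ⟨_, hl.sub
      (((c.continuous_kernelHF R r).tendsto 0).mono_left nhdsWithin_le_nhds)⟩ hC

/-! ### Asymptotic equivalence away from zeros -/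

lemma asymptoticOffZeros_of_norm_eq_sin {f g : ℝ → ℂ} {C K m z₀ : ℝ} (hK : 0 < K) (hm : 0 < m)
    (hfg : ∀ ω, 1 ≤ ω → ‖f ω - g ω‖ ≤ C / ω)
    (hg : ∀ ω, ‖g ω‖ = K * |Real.sin (m * (ω - z₀))|) : AsymptoticOffZeros f g := by
  -- The half-length (n+1)^{-1/2} tends to 0, yet keeps |g| above a multiple of ω^{-1/2} outside the
  -- intervals, far more than the error C/ω.
  refine ⟨fun n => z₀ + n * (π / m), fun n => ?_, ⟨π / m, by positivity, fun n => ?_⟩,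
    fun ε hε => ⟨fun n => 1 / √(n + 1), ?_, ?_⟩⟩
  · rw [← norm_eq_zero, hg, show m * (z₀ + n * (π / m) - z₀) = n * π by field_simp; ring,
      Real.sin_nat_mul_pi, abs_zero, mul_zero]
  · push_cast
    linarith
  · have h := (Real.tendsto_sqrt_atTop.comp
      (tendsto_atTop_add_const_right atTop (1 : ℝ) tendsto_natCast_atTop_atTop)).inv_tendsto_atTop
    exact h.congr fun n => by simp
  set A := m / π + 1 with hA
  have hA0 : 0 < A := by positivity
  -- √ω > B is exactly what makes C/ω smaller than ε times the lower bound for |g|; A is chosen so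
  -- that n + 1 ≤ A ω for the index n of the nearest zero.
  set B := C * √A / (ε * (K * (2 / π * m))) with hB
  filter_upwards [eventually_ge_atTop 1, eventually_ge_atTop z₀,
    eventually_ge_atTop (3 / 2 - z₀ * (m / π)),
    Real.tendsto_sqrt_atTop.eventually_gt_atTop B] with ω h1 h2 h3 h4 hω
  have hω0 : 0 < ω := by linarith
  -- The shift by 1/2 makes the floor of y the index of the nearest zero, so m * d stays in [-π/2,
  -- π/2], where Jordan's inequality |sin u| ≥ (2/π)|u| applies.
  set y := (ω - z₀) * (m / π) + 1 / 2 with hy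
  have hy0 : 0 ≤ y := by
    have := mul_nonneg (sub_nonneg.2 h2) (by positivity : 0 ≤ m / π)
    linarith
  set n := ⌊y⌋₊
  have hn1 : (n : ℝ) ≤ y := Nat.floor_le hy0
  have hn2 : y < n + 1 := Nat.lt_floor_add_one y
  have hn := hω n
  set d := ω - (z₀ + n * (π / m)) with hd
  have e1 : m * (ω - z₀) = m * d + n * π := by rw [hd]; field_simp; ring
  have e2 : m * d = (y - 1 / 2 - n) * π := by rw [hd, hy]; field_simp; ring
  have hmd : |m * d| ≤ π / 2 := by
    rw [e2, abs_mul, abs_of_pos pi_pos]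
    have : |y - 1 / 2 - n| ≤ 1 / 2 := abs_le.2 ⟨by linarith, by linarith⟩
    nlinarith [pi_pos]
  have hs1 : |Real.sin (m * (ω - z₀))| = |Real.sin (m * d)| := by
    rw [e1, Real.sin_add_nat_mul_pi, abs_mul, abs_pow, abs_neg, abs_one, one_pow, one_mul]
  have hs2 : 2 / π * |m * d| ≤ |Real.sin (m * d)| := Real.mul_abs_le_abs_sin hmd
  have hnA : (n : ℝ) + 1 ≤ A * ω := by
    have : y = ω * (m / π) - z₀ * (m / π) + 1 / 2 := by rw [hy]; ring
    rw [hA, add_mul, one_mul, mul_comm (m / π)]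
    linarith
  have hsq : √((n : ℝ) + 1) ≤ √A * √ω := by
    rw [← Real.sqrt_mul hA0.le]
    exact Real.sqrt_le_sqrt hnA
  have hsω := Real.sqrt_pos.2 hω0
  have hsA := Real.sqrt_pos.2 hA0
  have hd' : 1 / (√A * √ω) < |d| :=
    (one_div_le_one_div_of_le (by positivity) hsq).trans_lt hn
  have hgl : K * (2 / π * m) / (√A * √ω) < ‖g ω‖ := by
    rw [hg, hs1]
    calc K * (2 / π * m) / (√A * √ω) = K * (2 / π * (m * (1 / (√A * √ω)))) := by ring
      _ < K * (2 / π * (m * |d|)) := by gcongr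
      _ = K * (2 / π * |m * d|) := by rw [abs_mul, abs_of_pos hm]
      _ ≤ _ := by gcongr
  have hgpos : 0 < ‖g ω‖ := lt_of_le_of_lt (by positivity) hgl
  have hg0 : g ω ≠ 0 := norm_pos_iff.1 hgpos
  refine ⟨hg0, ?_⟩
  rw [div_sub_one hg0, norm_div, div_lt_iff₀ hgpos]
  calc ‖f ω - g ω‖ ≤ C / ω := hfg ω h1
    _ < ε * (K * (2 / π * m) / (√A * √ω)) := by
      rw [hB, div_lt_iff₀ (by positivity)] at h4
      rw [div_lt_iff₀ hω0]
      have e3 : ε * (K * (2 / π * m) / (√A * √ω)) * ω = ε * (K * (2 / π * m)) * √ω / √A := by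
        field_simp
        rw [Real.sq_sqrt hω0.le]
      rw [e3, lt_div_iff₀ hsA]
      linarith
    _ < _ := by gcongr

lemma norm_neg_exp_add_exp (a b : ℝ) :
    ‖-Complex.exp (Complex.I * (a : ℂ)) + Complex.exp (Complex.I * (b : ℂ))‖ =
      2 * |Real.sin ((b - a) / 2)| := by
  have e : -Complex.exp (Complex.I * (a : ℂ)) + Complex.exp (Complex.I * (b : ℂ)) =
      Complex.exp (Complex.I * (a : ℂ)) * (Complex.exp (Complex.I * ((b - a : ℝ) : ℂ)) - 1) := by
    rw [mul_sub, ← Complex.exp_add, mul_one]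
    push_cast
    ring_nf
  rw [e, norm_mul, mul_comm Complex.I (a : ℂ), Complex.norm_exp_ofReal_mul_I, one_mul,
    Complex.norm_exp_I_mul_ofReal_sub_one, norm_mul, Real.norm_eq_abs, Real.norm_eq_abs, abs_two]

/-- The two frequencies differ by twice the inner radius, so factoring out one exponential leaves
|e^{iθ} - 1| = 2|sin(θ/2)|. For the plus sign, the first exponential is rewritten with an extra
phase -π. -/
lemma Field.exists_norm_kernelHF {R r : ℝ} (hR : 0 < R) (hr : 0 < r) {c : Field}
    (hc : c.Region R r) : ∃ z₀ : ℝ, ∀ ω : ℝ,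
      ‖c.kernelHF R r ω‖ = √(R / r) * |Real.sin (c.inner R r * (ω - z₀))| := by
  have hi := c.inner_pos hR hr
  have h1 : (R + r) - |r - R| = 2 * c.inner R r := by
    rw [← Field.outer_sub_inner hc, ← c.outer_add_inner]; ring
  rcases c.sign_eq with hs | hs
  · refine ⟨-(π / 4) / c.inner R r, fun ω => ?_⟩
    have e : (1 : ℂ) * Complex.exp (Complex.I * ((|r - R| * ω : ℝ) : ℂ)) =
        -Complex.exp (Complex.I * ((|r - R| * ω - π : ℝ) : ℂ)) := by
      have e3 := Complex.exp_add (π * Complex.I) (Complex.I * ((|r - R| * ω - π : ℝ) : ℂ))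
      rw [Complex.exp_pi_mul_I, neg_one_mul] at e3
      rw [one_mul, ← e3]
      push_cast
      ring_nf
    rw [kernelHF, hs, Complex.ofReal_one, e, norm_mul, norm_neg_exp_add_exp, norm_mul,
      Complex.norm_real, Real.norm_of_nonneg (Real.sqrt_nonneg _)]
    have e2 : ((R + r) * ω - π / 2 - (|r - R| * ω - π)) / 2 =
        c.inner R r * (ω - -(π / 4) / c.inner R r) := by
      field_simp
      linear_combination (8 * ω) * h1
    rw [e2]
    norm_num
    ring
  · refine ⟨π / 4 / c.inner R r, fun ω => ?_⟩
    rw [kernelHF, hs, Complex.ofReal_neg, Complex.ofReal_one, neg_one_mul, norm_mul,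
      norm_neg_exp_add_exp, norm_mul, Complex.norm_real, Real.norm_of_nonneg (Real.sqrt_nonneg _)]
    have e2 : ((R + r) * ω - π / 2 - |r - R| * ω) / 2 =
        c.inner R r * (ω - π / 4 / c.inner R r) := by
      field_simp
      linear_combination (8 * ω) * h1
    rw [e2]
    norm_num
    ring

theorem Field.asymptoticOffZeros {R r : ℝ} (hR : 0 < R) (hr : 0 < r) {c : Field}
    (hc : c.Region R r) : AsymptoticOffZeros (c.kernel R r) (c.kernelHF R r) := by
  obtain ⟨C, hC⟩ := Field.exists_kernelSI_bound hR hr hc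
  obtain ⟨z₀, hz⟩ := Field.exists_norm_kernelHF hR hr hc
  exact asymptoticOffZeros_of_norm_eq_sin (Real.sqrt_pos.2 (by positivity)) (c.inner_pos hR hr)
    hC hz

theorem Field.tendsto_kernelSI {R r : ℝ} (hR : 0 < R) (hr : 0 < r) {c : Field}
    (hc : c.Region R r) :
    Tendsto (fun ω : ℝ => c.kernel R r ω - c.kernelHF R r ω) atTop (𝓝 0) := by
  obtain ⟨C, hC⟩ := Field.exists_kernelSI_bound hR hr hc
  exact squeeze_zero_norm' ((eventually_ge_atTop 1).mono hC) (tendsto_const_nhds.div_atTop tendsto_id)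

/-! ### The modified inverse Fourier transform -/

open FourierTransform ComplexConjugate

/-- The function `ξ ↦ g (2 π ξ) + conj (g (-2 π ξ))`. -/
def hermitize (g : ℝ → ℂ) (ξ : ℝ) : ℂ := g (2 * π * ξ) + conj (g (-(2 * π * ξ)))

lemma integrable_comp_two_pi_mul {g : ℝ → ℂ} (hg : Integrable g) :
    Integrable (fun ξ => g (2 * π * ξ)) :=
  hg.comp_mul_left' (by positivity)

lemma integrable_conj {g : ℝ → ℂ} (hg : Integrable g) : Integrable (fun ξ => conj (g ξ)) := by
  refine hg.mono (Complex.continuous_conj.comp_aestronglyMeasurable hg.aestronglyMeasurable) ?_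
  exact Eventually.of_forall fun ξ => by simp

lemma integrable_hermitize {g : ℝ → ℂ} (hg : Integrable g) : Integrable (hermitize g) := by
  have h := integrable_comp_two_pi_mul hg
  refine h.add ?_
  have := integrable_conj h.comp_neg
  simpa using this

lemma integrable_indicator_of_intervalIntegrable {h : ℝ → ℂ} {Λ : ℝ} (hΛ : 0 < Λ)
    (hi : IntervalIntegrable h volume 0 Λ) : Integrable ((Ioc 0 Λ).indicator h) := by
  rw [integrable_indicator_iff measurableSet_Ioc]
  exact (intervalIntegrable_iff_integrableOn_Ioc_of_le hΛ.le).1 hi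

/-- Taking the real part adds half the complex conjugate, which is the contribution of negative
frequencies of the Hermitian extension. With ω = 2πξ the factor 1/π becomes 2, cancelling that half.
-/
lemma truncatedModifiedIFT_eq_fourier {h : ℝ → ℂ} {Λ : ℝ} (hΛ : 0 < Λ)
    (hi : IntervalIntegrable h volume 0 Λ) (t : ℝ) :
    (truncatedModifiedIFT h Λ t : ℂ) = 𝓕 (hermitize ((Ioc 0 Λ).indicator h)) t := by
  set g := (Ioc 0 Λ).indicator h with hg
  have hgi : Integrable g := integrable_indicator_of_intervalIntegrable hΛ hi
  set u : ℝ → ℂ := fun ξ => Complex.exp ((-2 * π * ξ * t : ℝ) * Complex.I) * g (2 * π * ξ) with hu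
  have hui : Integrable u := by
    refine (integrable_comp_two_pi_mul hgi).bdd_mul (c := 1) (by fun_prop) ?_
    exact Eventually.of_forall fun ξ => by rw [Complex.norm_exp_ofReal_mul_I]
  have e1 : 1 / (π : ℂ) * ∫ ω in (0 : ℝ)..Λ, h ω * Complex.exp (-(Complex.I * ((ω * t : ℝ) : ℂ))) =
      2 * ∫ ξ, u ξ := by
    have h1 := Measure.integral_comp_mul_left
      (fun ω : ℝ => Complex.exp (-(Complex.I * ((ω * t : ℝ) : ℂ))) * g ω) (2 * π)
    have h2 : ∫ ω in (0 : ℝ)..Λ, h ω * Complex.exp (-(Complex.I * ((ω * t : ℝ) : ℂ))) =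
        ∫ ω, Complex.exp (-(Complex.I * ((ω * t : ℝ) : ℂ))) * g ω := by
      rw [intervalIntegral.integral_of_le hΛ.le, ← integral_indicator measurableSet_Ioc]
      refine integral_congr_ae (Eventually.of_forall fun ω => ?_)
      simp only [hg, Set.indicator_apply]
      split_ifs
      · ring
      · simp
    have h3 : ∫ ξ, u ξ = ∫ ξ : ℝ, Complex.exp (-(Complex.I * ((2 * π * ξ * t : ℝ) : ℂ)))
        * g (2 * π * ξ) := by
      refine integral_congr_ae (Eventually.of_forall fun ξ => ?_)
      simp only [hu]
      congr 2
      push_cast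
      ring
    rw [h2, h3, h1, abs_of_pos (by positivity), Complex.real_smul]
    have := Complex.ofReal_ne_zero.2 pi_ne_zero
    generalize ∫ ω : ℝ, Complex.exp (-(Complex.I * ((ω * t : ℝ) : ℂ))) * g ω = S
    push_cast
    field_simp
  have e2 : 𝓕 (hermitize g) t = (∫ ξ, u ξ) + conj (∫ ξ, u ξ) := by
    rw [← integral_conj, ← integral_neg_eq_self (fun ξ => conj (u ξ)),
      ← integral_add hui (integrable_conj hui).comp_neg, Real.fourier_real_eq_integral_exp_smul]
    refine integral_congr_ae (Eventually.of_forall fun ξ => ?_)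
    simp only [hu, hermitize, smul_eq_mul, map_mul, ← Complex.exp_conj, Complex.conj_I,
      Complex.conj_ofReal, mul_add]
    congr 2
    · congr 1
      push_cast
      ring
    · congr 2
      ring
  rw [truncatedModifiedIFT, e1, e2, ← Complex.ofReal_ofNat, Complex.re_ofReal_mul,
    Complex.add_conj]

lemma integral_truncatedModifiedIFT_mul {h : ℝ → ℂ} {Λ : ℝ} (hΛ : 0 < Λ)
    (hi : IntervalIntegrable h volume 0 Λ) (φ : 𝓢(ℝ, ℂ)) :
    ∫ t : ℝ, (truncatedModifiedIFT h Λ t : ℂ) * φ t =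
      ∫ ξ, hermitize ((Ioc 0 Λ).indicator h) ξ * 𝓕 φ ξ := by
  simp only [truncatedModifiedIFT_eq_fourier hΛ hi, SchwartzMap.fourier_coe]
  have h1 := integrable_hermitize (integrable_indicator_of_intervalIntegrable hΛ hi)
  simpa using! VectorFourier.integral_fourierIntegral_smul_eq_flip (L := innerₗ ℝ)
    Real.continuous_fourierChar continuous_inner h1 φ.integrable

lemma norm_hermitize_le (g : ℝ → ℂ) (ξ : ℝ) :
    ‖hermitize g ξ‖ ≤ ‖g (2 * π * ξ)‖ + ‖g (-(2 * π * ξ))‖ :=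
  (norm_add_le _ _).trans_eq (by rw [RCLike.norm_conj])

/-- Once the Fourier transform is moved onto φ, removing the cutoff is dominated convergence on the
frequency side; `hb` serves both bounded and square-integrable h. -/
lemma tendsto_integral_truncatedModifiedIFT {h : ℝ → ℂ}
    (hi : ∀ Λ : ℝ, 0 < Λ → IntervalIntegrable h volume 0 Λ) (φ : 𝓢(ℝ, ℂ))
    (hb : Integrable fun ξ => (‖(Ioi 0).indicator h (2 * π * ξ)‖
      + ‖(Ioi 0).indicator h (-(2 * π * ξ))‖) * ‖𝓕 φ ξ‖) :
    Tendsto (fun Λ : ℝ => ∫ t : ℝ, (truncatedModifiedIFT h Λ t : ℂ) * φ t) atTop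
      (𝓝 (∫ ξ, hermitize ((Ioi 0).indicator h) ξ * 𝓕 φ ξ)) := by
  have hind : ∀ Λ x : ℝ, ‖(Ioc 0 Λ).indicator h x‖ ≤ ‖(Ioi 0).indicator h x‖ := fun Λ x => by
    simp only [norm_indicator_eq_indicator_norm]
    exact indicator_le_indicator_of_subset Ioc_subset_Ioi_self (fun _ => norm_nonneg _) x
  have hlim : ∀ x : ℝ, ∀ᶠ Λ in atTop, (Ioc 0 Λ).indicator h x = (Ioi 0).indicator h x := fun x => by
    filter_upwards [eventually_ge_atTop x] with Λ hΛ
    simp [Set.indicator_apply, hΛ]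
  have key := tendsto_integral_filter_of_dominated_convergence (l := atTop) (μ := volume)
    (F := fun Λ ξ => hermitize ((Ioc 0 Λ).indicator h) ξ * 𝓕 φ ξ)
    (f := fun ξ => hermitize ((Ioi 0).indicator h) ξ * 𝓕 φ ξ) _ ?_ ?_ hb ?_
  · refine key.congr' ?_
    filter_upwards [eventually_gt_atTop 0] with Λ hΛ
    exact (integral_truncatedModifiedIFT_mul hΛ (hi Λ hΛ) φ).symm
  · filter_upwards [eventually_gt_atTop 0] with Λ hΛ
    exact (integrable_hermitize (integrable_indicator_of_intervalIntegrable hΛ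
      (hi Λ hΛ))).aestronglyMeasurable.mul (𝓕 φ).continuous.aestronglyMeasurable
  · refine Eventually.of_forall fun Λ => Eventually.of_forall fun ξ => ?_
    rw [norm_mul]
    refine mul_le_mul_of_nonneg_right ((norm_hermitize_le _ _).trans ?_) (norm_nonneg _)
    exact add_le_add (hind _ _) (hind _ _)
  · refine Eventually.of_forall fun ξ => ?_
    refine tendsto_const_nhds.congr' ?_
    filter_upwards [hlim (2 * π * ξ), hlim (-(2 * π * ξ))] with Λ h1 h2
    simp only [hermitize, h1, h2]

/-! ### Linearity -/

lemma truncatedModifiedIFT_ofReal_mul (a : ℝ) (h : ℝ → ℂ) (Λ t : ℝ) :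
    truncatedModifiedIFT (fun ω => a * h ω) Λ t = a * truncatedModifiedIFT h Λ t := by
  simp only [truncatedModifiedIFT, mul_assoc, intervalIntegral.integral_const_mul]
  rw [mul_left_comm, Complex.re_ofReal_mul]

lemma IsModifiedIFT.ofReal_smul {h : ℝ → ℂ} {T : 𝓢'(ℝ, ℂ)} (hT : IsModifiedIFT h T) (a : ℝ) :
    IsModifiedIFT (fun ω => a * h ω) ((a : ℂ) • T) := by
  refine ⟨fun Λ hΛ => (hT.1 Λ hΛ).const_mul _, fun φ => ?_⟩
  simp only [truncatedModifiedIFT_ofReal_mul, Complex.ofReal_mul, mul_assoc, integral_const_mul]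
  exact (hT.2 φ).const_mul _

lemma hermitize_add (g h : ℝ → ℂ) (ξ : ℝ) :
    hermitize (g + h) ξ = hermitize g ξ + hermitize h ξ := by
  simp only [hermitize, Pi.add_apply, map_add]
  ring

lemma integrable_mul_fourier {g : ℝ → ℂ} (hg : Integrable g) (φ : 𝓢(ℝ, ℂ)) :
    Integrable fun ξ => g ξ * 𝓕 φ ξ := by
  refine hg.mul_bdd (c := SchwartzMap.seminorm ℂ 0 0 (𝓕 φ))
    (𝓕 φ).continuous.aestronglyMeasurable ?_
  exact Eventually.of_forall fun ξ => SchwartzMap.norm_le_seminorm ℂ (𝓕 φ) ξ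

/-- The splitting is made on the frequency side, where a truncated h is integrable and 𝓕 φ is
bounded. -/
lemma IsModifiedIFT.add {h₁ h₂ : ℝ → ℂ} {T₁ T₂ : 𝓢'(ℝ, ℂ)} (hT₁ : IsModifiedIFT h₁ T₁)
    (hT₂ : IsModifiedIFT h₂ T₂) : IsModifiedIFT (fun ω => h₁ ω + h₂ ω) (T₁ + T₂) := by
  refine ⟨fun Λ hΛ => (hT₁.1 Λ hΛ).add (hT₂.1 Λ hΛ), fun φ => ?_⟩
  refine ((hT₁.2 φ).add (hT₂.2 φ)).congr' ?_
  filter_upwards [eventually_gt_atTop 0] with Λ hΛ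
  have i₁ := hT₁.1 Λ hΛ
  have i₂ := hT₂.1 Λ hΛ
  rw [integral_truncatedModifiedIFT_mul hΛ i₁, integral_truncatedModifiedIFT_mul hΛ i₂,
    integral_truncatedModifiedIFT_mul hΛ (i₁.add i₂), ← integral_add
      (integrable_mul_fourier (integrable_hermitize (integrable_indicator_of_intervalIntegrable hΛ i₁)) φ)
      (integrable_mul_fourier (integrable_hermitize (integrable_indicator_of_intervalIntegrable hΛ i₂)) φ)]
  refine integral_congr_ae (Eventually.of_forall fun ξ => ?_)
  have e : (Ioc 0 Λ).indicator (fun ω => h₁ ω + h₂ ω) =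
      (Ioc 0 Λ).indicator h₁ + (Ioc 0 Λ).indicator h₂ := Set.indicator_add' _ h₁ h₂
  simp only [e, hermitize_add]
  ring

/-! ### The delta distribution -/

/-- The Hermitian extension of the half-line exponential is e^{2πiaξ} for every ξ ≠ 0, so the limit
is Fourier inversion for φ at a. -/
theorem isModifiedIFT_exp_delta (a : ℝ) :
    IsModifiedIFT (fun ω => Complex.exp (Complex.I * ((a * ω : ℝ) : ℂ)))
      (TemperedDistribution.delta a) := by
  have hi : ∀ Λ : ℝ, 0 < Λ → IntervalIntegrable
      (fun ω : ℝ => Complex.exp (Complex.I * ((a * ω : ℝ) : ℂ))) volume 0 Λ :=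
    fun Λ _ => Continuous.intervalIntegrable (by fun_prop) _ _
  refine ⟨hi, fun φ => ?_⟩
  have hbd : ∀ x : ℝ, ‖(Ioi (0 : ℝ)).indicator
      (fun ω : ℝ => Complex.exp (Complex.I * ((a * ω : ℝ) : ℂ))) x‖ ≤ 1 := fun x => by
    refine (norm_indicator_le_norm_self _ _).trans ?_
    rw [Complex.norm_exp_I_mul_ofReal]
  have hm : Measurable ((Ioi (0 : ℝ)).indicator
      (fun ω : ℝ => Complex.exp (Complex.I * ((a * ω : ℝ) : ℂ)))) :=
    Measurable.indicator (by fun_prop) measurableSet_Ioi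
  have h := tendsto_integral_truncatedModifiedIFT hi φ (by
    refine ((𝓕 φ).integrable (μ := volume)).norm.bdd_mul (c := 2) (by fun_prop) ?_
    refine Eventually.of_forall fun ξ => ?_
    rw [Real.norm_of_nonneg (by positivity)]
    linarith [hbd (2 * π * ξ), hbd (-(2 * π * ξ))])
  convert h using 2
  have h1 : 𝓕⁻ (𝓕 φ) a = φ a := by rw [FourierTransform.fourierInv_fourier_eq]
  rw [TemperedDistribution.delta_apply, ← h1, SchwartzMap.fourierInv_coe, Real.fourierInv_eq']
  have hae : ∀ᵐ ξ : ℝ, ξ ≠ 0 := by simp [ae_iff]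
  refine integral_congr_ae (hae.mono fun ξ hξ => ?_)
  simp only [smul_eq_mul]
  congr 1
  simp only [hermitize, Set.indicator_apply, mem_Ioi]
  rcases lt_or_gt_of_ne hξ with h0 | h0
  · have h2 : ¬ 0 < 2 * π * ξ := not_lt.2 (mul_nonpos_of_nonneg_of_nonpos (by positivity) h0.le)
    have h3 : 0 < -(2 * π * ξ) := by
      have := mul_pos (by positivity : 0 < 2 * π) (neg_pos.2 h0)
      linarith
    rw [if_neg h2, if_pos h3, zero_add, ← Complex.exp_conj, map_mul, Complex.conj_I,
      Complex.conj_ofReal]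
    congr 1
    simp
    ring
  · have h2 : 0 < 2 * π * ξ := by positivity
    have h3 : ¬ 0 < -(2 * π * ξ) := by linarith
    rw [if_pos h2, if_neg h3, map_zero, add_zero]
    congr 1
    simp
    ring

/-! ### The principal value -/

/-- Riemann-Lebesgue, applied at the frequencies ±Λ/(2π) and averaged. -/
lemma tendsto_integral_cos_mul {f : ℝ → ℂ} (hf : Integrable f) :
    Tendsto (fun Λ : ℝ => ∫ s, ((Real.cos (Λ * s) : ℝ) : ℂ) * f s) atTop (𝓝 0) := by
  have h := Real.tendsto_integral_exp_smul_cocompact f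
  have h1 := h.comp ((tendsto_id.atTop_div_const (by positivity : 0 < 2 * π)).mono_right
    atTop_le_cocompact)
  have h2 := h.comp ((tendsto_neg_atTop_atBot.comp
    (tendsto_id.atTop_div_const (by positivity : 0 < 2 * π))).mono_right atBot_le_cocompact)
  have h3 := (h1.add h2).const_mul (1 / 2)
  rw [add_zero, mul_zero] at h3
  refine h3.congr fun Λ => ?_
  have hi : ∀ w : ℝ, Integrable fun v => Real.fourierChar (-(v * w)) • f v := fun w => by
    refine (hf.bdd_mul (f := fun v : ℝ => Complex.exp ((2 * π * -(v * w) : ℝ) * Complex.I)) (c := 1)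
      ?_ ?_).congr ?_
    · exact Continuous.aestronglyMeasurable (by fun_prop)
    · exact Eventually.of_forall fun v => by rw [Complex.norm_exp_ofReal_mul_I]
    · exact Eventually.of_forall fun v => by
        simp only [Circle.smul_def, Real.fourierChar_apply, smul_eq_mul]
  simp only [Function.comp_apply, id]
  rw [← integral_add (hi _) (hi _), ← integral_const_mul]
  refine integral_congr_ae (Eventually.of_forall fun s => ?_)
  simp only [Circle.smul_def, Real.fourierChar_apply, smul_eq_mul, Complex.ofReal_cos, Complex.cos]
  rw [← add_mul, ← mul_assoc]
  have hpi := Complex.ofReal_ne_zero.2 pi_ne_zero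
  congr 1
  rw [add_comm, one_div, inv_mul_eq_div]
  congr 3 <;> push_cast <;> field_simp

lemma truncatedModifiedIFT_exp_sub_pi_div_two (b Λ t : ℝ) :
    truncatedModifiedIFT (fun ω => Complex.exp (Complex.I * ((b * ω - π / 2 : ℝ) : ℂ))) Λ t =
      1 / π * ((1 - Real.cos (Λ * (b - t))) / (b - t)) := by
  have e : ∀ ω : ℝ, Complex.exp (Complex.I * ((b * ω - π / 2 : ℝ) : ℂ)) *
      Complex.exp (-(Complex.I * ((ω * t : ℝ) : ℂ))) =
      Complex.exp ((((b - t) * ω - π / 2 : ℝ) : ℂ) * Complex.I) := fun ω => by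
    rw [← Complex.exp_add]
    congr 1
    push_cast
    ring
  have hre := Complex.reCLM.intervalIntegral_comp_comm (μ := volume) (a := 0) (b := Λ)
    (f := fun ω : ℝ => Complex.exp ((((b - t) * ω - π / 2 : ℝ) : ℂ) * Complex.I))
    (Continuous.intervalIntegrable (by fun_prop) _ _)
  simp only [Complex.reCLM_apply, Complex.exp_ofReal_mul_I_re, Real.cos_sub_pi_div_two] at hre
  rw [truncatedModifiedIFT]
  simp only [e]
  rw [← Complex.ofReal_one, ← Complex.ofReal_div, Complex.re_ofReal_mul, ← hre]
  congr 1
  -- At t = b the integrand sin 0 vanishes, in agreement with the value 0 of division by zero.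
  rcases eq_or_ne (b - t) 0 with h0 | h0
  · simp [h0]
  · rw [intervalIntegral.integral_comp_mul_left (fun x => Real.sin x) h0, integral_sin, mul_zero,
      Real.cos_zero, smul_eq_mul, mul_comm Λ]
    field_simp

lemma abs_one_sub_cos_div_le {Λ : ℝ} (hΛ : 0 ≤ Λ) (s : ℝ) : |(1 - Real.cos (Λ * s)) / s| ≤ Λ := by
  rcases eq_or_ne s 0 with h0 | h0
  · simpa [h0]
  have h1 := Real.one_sub_sq_div_two_le_cos (x := Λ * s)
  have h2 := Real.cos_le_one (Λ * s)
  have h3 := Real.neg_one_le_cos (Λ * s)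
  rw [abs_div, div_le_iff₀ (abs_pos.2 h0)]
  refine abs_le_of_sq_le_sq ?_ (by positivity)
  rw [mul_pow, sq_abs, ← mul_pow]
  nlinarith

lemma integral_eq_integral_Ioi_add {f : ℝ → ℂ} (hf : Integrable f) :
    ∫ s, f s = ∫ s in Ioi (0 : ℝ), (f s + f (-s)) := by
  rw [integral_add hf.integrableOn hf.comp_neg.integrableOn, integral_comp_neg_Ioi, neg_zero,
    add_comm, intervalIntegral.integral_Iic_add_Ioi hf.integrableOn hf.integrableOn]

/-- The truncated transform is an odd kernel about b, so it sees only (φ(b+s) - φ(b-s))/s, which is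
integrable. In 1 - cos(Λs) the 1 gives the principal value and the cosine tends to 0 by
Riemann-Lebesgue. -/
theorem isModifiedIFT_exp_pvInv (b : ℝ) :
    IsModifiedIFT (fun ω => Complex.exp (Complex.I * ((b * ω - π / 2 : ℝ) : ℂ)))
      (-((1 / (π : ℂ)) • pvInv b)) := by
  refine ⟨fun Λ _ => Continuous.intervalIntegrable (by fun_prop) _ _, fun φ => ?_⟩
  set ψ : ℝ → ℂ := fun s => (φ (b + s) - φ (b - s)) / (s : ℂ) with hψ
  have hψi : IntegrableOn ψ (Ioi 0) := pv_integrableOn b φ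
  have hRL := tendsto_integral_cos_mul ((integrable_indicator_iff measurableSet_Ioi).2 hψi)
  have hT : (-((1 / (π : ℂ)) • pvInv b)) φ = -(1 / (π : ℂ)) * ((∫ s in Ioi (0 : ℝ), ψ s) - 0) := by
    rw [sub_zero, neg_mul]
    rfl
  rw [hT]
  refine ((tendsto_const_nhds.sub hRL).const_mul _).congr' ?_
  filter_upwards [eventually_gt_atTop 0] with Λ hΛ
  simp only [truncatedModifiedIFT_exp_sub_pi_div_two]
  rw [← integral_add_left_eq_self (μ := volume) (fun t : ℝ =>
    ((1 / π * ((1 - Real.cos (Λ * (b - t))) / (b - t)) : ℝ) : ℂ) * φ t) b]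
  set K : ℝ → ℝ := fun s => 1 / π * ((1 - Real.cos (Λ * s)) / s) with hK
  have hKodd : ∀ s, K (-s) = -K s := fun s => by simp only [hK, mul_neg, Real.cos_neg, div_neg]
  have hf : Integrable fun s : ℝ => (K (-s) : ℂ) * φ (b + s) := by
    refine (((φ.integrable (μ := volume)).comp_add_left b)).bdd_mul (c := 1 / π * Λ) ?_ ?_
    · have : Measurable K := by fun_prop
      exact Measurable.aestronglyMeasurable (by fun_prop)
    · refine Eventually.of_forall fun s => ?_
      rw [Complex.norm_real, Real.norm_eq_abs, hK, abs_mul, abs_of_pos (by positivity : 0 < 1 / π)]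
      gcongr
      exact abs_one_sub_cos_div_le hΛ.le _
  have e1 : ∫ s, ((1 / π * ((1 - Real.cos (Λ * (b - (b + s)))) / (b - (b + s))) : ℝ) : ℂ) *
      φ (b + s) = ∫ s in Ioi (0 : ℝ), -(1 / (π : ℂ)) *
        (ψ s - ((Real.cos (Λ * s) : ℝ) : ℂ) * ψ s) := by
    have e2 : ∀ s, b - (b + s) = -s := fun s => by ring
    simp only [e2]
    change ∫ s, (K (-s) : ℂ) * φ (b + s) = _
    rw [integral_eq_integral_Ioi_add hf]
    refine integral_congr_ae (Eventually.of_forall fun s => ?_)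
    simp only [neg_neg]
    rw [hKodd]
    simp only [hψ, ← sub_eq_add_neg, hK]
    push_cast
    ring
  have hc : IntegrableOn (fun s => ((Real.cos (Λ * s) : ℝ) : ℂ) * ψ s) (Ioi 0) := by
    refine hψi.bdd_mul (c := 1) (Continuous.aestronglyMeasurable (by fun_prop)) ?_
    exact Eventually.of_forall fun s => by
      rw [Complex.norm_real, Real.norm_eq_abs]; exact Real.abs_cos_le_one _
  have e3 : ∫ s, ((Real.cos (Λ * s) : ℝ) : ℂ) * (Ioi (0 : ℝ)).indicator ψ s =
      ∫ s in Ioi (0 : ℝ), ((Real.cos (Λ * s) : ℝ) : ℂ) * ψ s := by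
    rw [← integral_indicator measurableSet_Ioi]
    refine integral_congr_ae (Eventually.of_forall fun s => ?_)
    simp only [Set.indicator_apply]
    split_ifs <;> simp
  rw [e1, integral_const_mul, integral_sub hψi hc, e3]

theorem Field.isModifiedIFT_kernelHF (c : Field) (R r : ℝ) :
    IsModifiedIFT (c.kernelHF R r) (c.timeHF R r) := by
  have h := (((isModifiedIFT_exp_delta |r - R|).ofReal_smul c.sign).add
    (isModifiedIFT_exp_pvInv (R + r))).ofReal_smul (1 / 2 * √(R / r))
  have e : c.kernelHF R r = fun ω => ((1 / 2 * √(R / r) : ℝ) : ℂ) *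
      ((c.sign : ℂ) * Complex.exp (Complex.I * ((|r - R| * ω : ℝ) : ℂ))
        + Complex.exp (Complex.I * (((R + r) * ω - π / 2 : ℝ) : ℂ))) := by
    ext ω
    simp only [kernelHF]
    push_cast
    ring
  rw [e, timeHF, sub_eq_add_neg]
  exact h

/-! ### Square-integrable functions -/

lemma memLp_comp_mul_left {g : ℝ → ℂ} (hg : MemLp g 2 volume) {a : ℝ} (ha : a ≠ 0) :
    MemLp (fun ξ => g (a * ξ)) 2 volume := by
  refine MemLp.comp_of_map (f := fun ξ => a * ξ) (g := g) ?_ (by fun_prop)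
  rw [Real.map_volume_mul_left ha]
  exact hg.smul_measure ENNReal.ofReal_ne_top

lemma memLp_hermitize {g : ℝ → ℂ} (hg : MemLp g 2 volume) : MemLp (hermitize g) 2 volume := by
  refine (memLp_comp_mul_left hg (a := 2 * π) (by positivity)).add ?_
  have h := (memLp_comp_mul_left hg (a := -(2 * π)) (by simp)).star
  refine h.ae_eq (Eventually.of_forall fun ξ => ?_)
  simp [neg_mul]

/-- The complex conjugate of a Schwartz function. -/
def schwartzConj (φ : 𝓢(ℝ, ℂ)) : 𝓢(ℝ, ℂ) :=
  SchwartzMap.postcompCLM (𝕜 := ℝ) (Complex.conjCLE : ℂ →L[ℝ] ℂ) φ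

lemma schwartzConj_apply (φ : 𝓢(ℝ, ℂ)) (t : ℝ) : schwartzConj φ t = conj (φ t) := rfl

/-- Against 𝓕 φ, which lies in L², the Hermitian extension of h is integrable, so the truncations
converge, and the limit is represented by its L² Fourier transform G. -/
theorem exists_isModifiedIFT_of_memLp {h : ℝ → ℂ} (hh : MemLp h 2 (volume.restrict (Ioi 0))) :
    ∃ g : ℝ → ℝ, ∃ hL : MemLp (fun t : ℝ => (g t : ℂ)) 2 volume,
      IsModifiedIFT h (Lp.toTemperedDistribution hL.toLp) := by
  have hg : MemLp ((Ioi 0).indicator h) 2 volume :=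
    (memLp_indicator_iff_restrict measurableSet_Ioi).2 hh
  have hF := memLp_hermitize hg
  have hi : ∀ Λ : ℝ, 0 < Λ → IntervalIntegrable h volume 0 Λ := fun Λ hΛ => by
    rw [intervalIntegrable_iff_integrableOn_Ioc_of_le hΛ.le]
    exact MemLp.integrable one_le_two (hh.mono_measure
      (Measure.restrict_mono Ioc_subset_Ioi_self le_rfl))
  set G : Lp ℂ 2 (volume : Measure ℝ) := 𝓕 hF.toLp with hG
  have hlim : ∀ φ : 𝓢(ℝ, ℂ), Tendsto (fun Λ : ℝ => ∫ t : ℝ, (truncatedModifiedIFT h Λ t : ℂ) * φ t)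
      atTop (𝓝 (∫ t, φ t * G t)) := fun φ => by
    have hφ : MemLp (fun ξ => ‖𝓕 φ ξ‖) 2 volume := ((𝓕 φ).memLp 2).norm
    have hb : MemLp (fun ξ => ‖(Ioi 0).indicator h (2 * π * ξ)‖
        + ‖(Ioi 0).indicator h (-(2 * π * ξ))‖) 2 volume := by
      refine (memLp_comp_mul_left hg (a := 2 * π) (by positivity)).norm.add ?_
      have := (memLp_comp_mul_left hg (a := -(2 * π)) (by simp)).norm
      simpa [neg_mul] using this
    have h1 := tendsto_integral_truncatedModifiedIFT hi φ (hb.integrable_mul hφ)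
    have h2 : ∫ t, φ t * G t = ∫ ξ, hermitize ((Ioi 0).indicator h) ξ * 𝓕 φ ξ := by
      have h3 := Lp.toTemperedDistribution_apply G φ
      rw [hG, ← Lp.fourier_toTemperedDistribution_eq, TemperedDistribution.fourier_apply,
        Lp.toTemperedDistribution_apply] at h3
      simp only [smul_eq_mul] at h3
      rw [hG, ← h3]
      refine integral_congr_ae (hF.coeFn_toLp.mono fun ξ hξ => ?_)
      simp only [hξ, mul_comm]
    rw [h2]
    exact h1
  have hGm := Lp.memLp G
  have hL : MemLp (fun t : ℝ => ((G t).re : ℂ)) 2 volume := hGm.re.ofReal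
  refine ⟨fun t => (G t).re, hL, hi, fun φ => ?_⟩
  -- The truncated transforms are real, so testing with the conjugate of φ and conjugating shows
  -- that the conjugate of G represents the same limit; averaging replaces G by its real part.
  have hconj : Tendsto (fun Λ : ℝ => ∫ t : ℝ, (truncatedModifiedIFT h Λ t : ℂ) * φ t)
      atTop (𝓝 (∫ t, φ t * conj (G t))) := by
    have h1 := (Complex.continuous_conj.tendsto _).comp (hlim (schwartzConj φ))
    simp only [schwartzConj_apply, ← integral_conj, map_mul, Complex.conj_conj] at h1
    refine h1.congr fun Λ => ?_
    simp only [Function.comp_apply, ← integral_conj, map_mul, Complex.conj_conj, Complex.conj_ofReal]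
  have h2 := ((hlim φ).add hconj).const_mul (1 / 2)
  have hφ : MemLp (fun t => φ t) 2 volume := φ.memLp 2
  have i1 : Integrable fun t => φ t * G t := hφ.integrable_mul hGm
  have i2 : Integrable fun t => φ t * conj (G t) := hφ.integrable_mul hGm.star
  have h3 : Lp.toTemperedDistribution hL.toLp φ =
      1 / 2 * ((∫ t, φ t * G t) + ∫ t, φ t * conj (G t)) := by
    rw [Lp.toTemperedDistribution_apply, ← integral_add i1 i2, ← integral_const_mul]
    refine integral_congr_ae (hL.coeFn_toLp.mono fun t ht => ?_)
    simp only [smul_eq_mul]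
    rw [ht]
    simp only [Complex.re_eq_add_conj]
    ring
  rw [h3]
  refine h2.congr fun Λ => ?_
  ring

end

end Solenoid

/-- High-frequency asymptotics of the four solenoid kernels, square-integrability of the remainder,
and the resulting singular part of the time-domain Green's functions. -/
theorem mainTheorem3 (R r : ℝ) (hR : 0 < R) (hr : 0 < r) (c : Solenoid.Field)
    (hc : c.Region R r) :
    -- high-frequency asymptotics: absolute error tends to zero, and the ratio tends to one
    -- outside shrinking intervals around the zeros
    (Tendsto (fun ω : ℝ => c.kernel R r ω - c.kernelHF R r ω) atTop (𝓝 0) ∧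
      Solenoid.AsymptoticOffZeros (c.kernel R r) (c.kernelHF R r)) ∧
    -- the remainder is square-integrable over positive frequencies
    MemLp (c.kernelSI R r) 2 (volume.restrict (Ioi 0)) ∧
    -- closed form of the high-frequency part in the time domain
    Solenoid.IsModifiedIFT (c.kernelHF R r) (c.timeHF R r) ∧
    -- the time-domain Green's function is this singular part plus a square-integrable function,
    -- which is the modified inverse Fourier transform of the remainder
    (∃ gSI : ℝ → ℝ, ∃ hL : MemLp (fun t : ℝ => (gSI t : ℂ)) 2 volume,
      Solenoid.IsModifiedIFT (c.kernelSI R r) (Lp.toTemperedDistribution hL.toLp) ∧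
      Solenoid.IsModifiedIFT (c.kernel R r)
        (Lp.toTemperedDistribution hL.toLp + c.timeHF R r)) := by
  have hSI := Solenoid.Field.memLp_kernelSI hR hr hc
  have hHF := c.isModifiedIFT_kernelHF R r
  obtain ⟨g, hL, hg⟩ := Solenoid.exists_isModifiedIFT_of_memLp hSI
  refine ⟨⟨Solenoid.Field.tendsto_kernelSI hR hr hc, Solenoid.Field.asymptoticOffZeros hR hr hc⟩,
    hSI, hHF, g, hL, hg, ?_⟩
  have h := hg.add hHF
  simpa only [Solenoid.Field.kernelSI, sub_add_cancel] using h
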